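/- Let $n,d,p\ge 1$ be integers, let $\Sigma^\natural\in\mathbb R^{p\times p}$ be a covariance matrix (symmetric positive semidefinite) with unit diagonal, and let $\sigma\ge 0$. Let $\tilde A\in\mathbb R^{d\times p}$ have i.i.d. entries $\tilde A_{ij}\sim N(0,1/d)$, let $X^{(1)},\dots,X^{(n)}$ be i.i.d. $N(0,\Sigma^\natural)$ in $\mathbb R^p$, let $W^{(1)},\dots,W^{(n)}$ be i.i.d. $N(0,\sigma^2 I_d)$, with $\tilde A$, $(X^{(s)})_s$, $(W^{(s)})_s$ mutually independent, and observe $Y^{(s)}=\tilde A X^{(s)}+W^{(s)}$, $1\le s\le n$. Consider the estimator \[ \widehat\Sigma^{\mathrm{param}}_n = I+\frac{d}{d+1}\Big[\tilde A^{\mathsf T}\Big(\frac1n\sum_{s=1}^n Y^{(s)}Y^{(s)\mathsf T}\Big)\tilde A\Big]_{\mathrm{off}}, \] where $[\cdot]_{\mathrm{off}}$ keeps the off-diagonal entries and sets the diagonal ones to $0$. Write $\|M\|_\infty=\max_{i,j}|M_{ij}|$, $\|M\|_{\mathrm{off},F}=(\sum_{i\ne j}M_{ij}^2)^{1/2}$,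 $a\vee b=\max(a,b)$, let $\Sigma^\natural_i$ be the $i$-th column of $\Sigma^\natural$, and for $C>0$ put \begin{align*} \tau_\infty = C\Big[&\sqrt{\tfrac{\log p}{n}}+\sqrt{\tfrac{\log p}{d}}\,\max_i\|\Sigma^\natural_i\|_2+\tfrac{\log p}{d}\big(1+\tfrac pd\big)\|\Sigma^\natural\|_{\mathrm{off},F}+\tfrac{\sqrt p\,\log p}{\sqrt{nd}}+\tfrac{p(\log p)^{3/2}}{\sqrt n\, d}\big(1+\tfrac pd\big)\\ &+\tfrac{\sqrt{p\log p}}{d}+\tfrac{p\sqrt{\log p}}{d^{3/2}}+\sigma^2\Big(1+\sqrt{\tfrac{\log p}{d}}\Big)\sqrt{\tfrac{\log p}{d}}\Big(1+\sqrt{\tfrac dn}\vee\tfrac dn\Big)\Big]. \end{align*} Then for every $K>0$ there are constants $c_0,c_1,c_2,c_3,c_4,C>0$, depending only on $K$, such that for all $n,d,p,\Sigma^\natural,\sigma$ as above with $\log p\le K n$, \[ \Pr\big(\|\widehat\Sigma^{\mathrm{param}}_n-\Sigma^\natural\|_\infty\le\tau_\infty\big)\ \ge\ 1-c_0p^{-1}-c_1p^2e^{-c_2d}-c_3p^2e^{-c_4p}.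 \] -/

import Mathlib

open MeasureTheory ProbabilityTheory
open scoped NNReal Matrix

namespace IndirectCov

noncomputable section

/-- Joint law of `(A, (X⁽¹⁾,…,X⁽ⁿ⁾), (W⁽¹⁾,…,W⁽ⁿ⁾))`: the entries of the `d × p` sensing matrix
`A` are i.i.d. `N(0, 1/d)`, the signals `X⁽ˢ⁾` are i.i.d. `N(0, S)` in `ℝᵖ`, the entries of the
noise vectors `W⁽ˢ⁾` are i.i.d. `N(0, σ²)`, and `A`, `X`, `W` are mutually independent. -/
def modelLaw (n d p : ℕ) (S : Matrix (Fin p) (Fin p) ℝ) (σ : ℝ≥0) :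
    Measure ((Fin d → Fin p → ℝ) × (Fin n → EuclideanSpace ℝ (Fin p)) × (Fin n → Fin d → ℝ)) :=
  (Measure.pi fun _ : Fin d => Measure.pi fun _ : Fin p => gaussianReal 0 ((d : ℝ≥0)⁻¹)).prod
    ((Measure.pi fun _ : Fin n => multivariateGaussian 0 S).prod
      (Measure.pi fun _ : Fin n => Measure.pi fun _ : Fin d => gaussianReal 0 (σ ^ 2)))

/-- The observations `Y⁽ˢ⁾ = A X⁽ˢ⁾ + W⁽ˢ⁾`. -/
def obs {n d p : ℕ} (A : Fin d → Fin p → ℝ) (X : Fin n → EuclideanSpace ℝ (Fin p))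
    (W : Fin n → Fin d → ℝ) (s : Fin n) : Fin d → ℝ :=
  Matrix.of A *ᵥ (X s).ofLp + W s

/-- The part of a square matrix off the diagonal, with zeros on the diagonal. -/
def offDiag {p : ℕ} (M : Matrix (Fin p) (Fin p) ℝ) : Matrix (Fin p) (Fin p) ℝ :=
  Matrix.of fun i j => if i = j then 0 else M i j

/-- The empirical second-moment matrix `(1/n) ∑ₛ Y⁽ˢ⁾ Y⁽ˢ⁾ᵀ`. -/
def empMoment {n d : ℕ} (Y : Fin n → Fin d → ℝ) : Matrix (Fin d) (Fin d) ℝ :=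
  (n : ℝ)⁻¹ • ∑ s, Matrix.vecMulVec (Y s) (Y s)

/-- The estimator `I + d/(d+1) [Aᵀ ((1/n) ∑ₛ Y⁽ˢ⁾ Y⁽ˢ⁾ᵀ) A]_off`. -/
def covEstimator {n d p : ℕ} (A : Fin d → Fin p → ℝ) (Y : Fin n → Fin d → ℝ) :
    Matrix (Fin p) (Fin p) ℝ :=
  1 + ((d : ℝ) / ((d : ℝ) + 1)) • offDiag ((Matrix.of A)ᵀ * empMoment Y * Matrix.of A)

/-- The entrywise maximum norm `max_{i,j} |M i j|`. -/
def maxNorm {p : ℕ} (M : Matrix (Fin p) (Fin p) ℝ) : ℝ :=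
  ⨆ i, ⨆ j, |M i j|

/-- The largest Euclidean norm of a column. -/
def maxColNorm {p : ℕ} (M : Matrix (Fin p) (Fin p) ℝ) : ℝ :=
  ⨆ j, √(∑ i, M i j ^ 2)

/-- The Frobenius norm of the off-diagonal part, `√(∑_{i ≠ j} (M i j)²)`. -/
def offFrobNorm {p : ℕ} (M : Matrix (Fin p) (Fin p) ℝ) : ℝ :=
  √(∑ i, ∑ j, if i = j then 0 else M i j ^ 2)

/-- The error level `τ_∞`, up to the constant `C`. -/
def tauInf (C : ℝ) (n d p : ℕ) (S : Matrix (Fin p) (Fin p) ℝ) (σ : ℝ≥0) : ℝ :=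
  let L := Real.log p
  C * (√(L / n)
    + √(L / d) * maxColNorm S
    + L / d * (1 + p / d) * offFrobNorm S
    + L * √p / √(n * d)
    + p * L ^ (3 / 2 : ℝ) / (√n * d) * (1 + p / d)
    + √(p * L) / d
    + p * √L / (d : ℝ) ^ (3 / 2 : ℝ)
    + (σ : ℝ) ^ 2 * (1 + √(L / d)) * √(L / d) * (1 + max √((d : ℝ) / n) ((d : ℝ) / n)))

end

end IndirectCov

/-! Put `g = AᵀA`, `L = log p`, `ε = 40√(L/d)`. The diagonal of the error vanishes, so fix `i ≠ j`
and let `c = eᵢ ± eⱼ` (`pairVec`). By polarization, four times the `(i,j)` entry of `Aᵀ(empirical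
moment)A` is a difference of two empirical means of squares `((A c)·Y⁽ˢ⁾)²`. For fixed `A` these are
squares of i.i.d. centred Gaussians of variance `pairVar`, so each mean is within a relative error
of order `√(L/n)` of `pairVar` (`obs_second_moment_tail`), and `pairVar` is of order at most `1 +
pL/d + σ²` (`pairVar_le`).

The difference of the two variances is `4(gᵢᵀ S gⱼ + σ² gᵢⱼ)`, where `gᵢ` is a column of `g`. The
noise part is small because `|gᵢⱼ| ≤ ε`. For the signal part write `gᵢ = eᵢ + e`, `gⱼ = eⱼ + f`, so
that `gᵢᵀ S gⱼ - Sᵢⱼ = (S f)ᵢ + (S e)ⱼ + eᵀ S f`. The linear terms are entries of `g S - S`,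
controlled by the largest column norm of `S`. In `eᵀ S f` the coordinates `i`, `j` are removed at
cost `O(ε²)` times that norm. What remains is polarized into forms `zᵀ S z`, with `z` the part of `g
c` outside `{i,j}`.

The point is independence: `A c` involves only columns `i`, `j` of `A`, so given `A c` the
coordinates of `z` are i.i.d. Gaussian of variance `β = |A c|²/d` (`sensing_conditional_bound`). The
off-diagonal part of `zᵀ S z` is a trace-zero Gaussian quadratic form, bounded by Hanson–Wright; the
diagonal part `|z|²` concentrates at `(p-2)β`. Under polarization these centres leave only `(p-2)
gᵢⱼ/d`.

Every bad event has probability `O(p⁻⁴)`, and a union bound over the `p²` pairs finishes when `1 ≤ L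
≤ d`. In the other regimes the claimed lower bound is at most zero. -/

namespace IndirectCov

section

/-! ### Exponential moments of Gaussian quadratic forms -/

/-- Second-order Taylor bound `|log(1-2t) + 2t| ≤ 8t²` for `|2t| ≤ 1/2`, halved by the square root.
-/
lemma exp_neg_div_sqrt_le {t : ℝ} (ht : |t| ≤ 1 / 4) :
    Real.exp (-t) * (√(1 - 2 * t))⁻¹ ≤ Real.exp (4 * t ^ 2) := by
  obtain ⟨h1, h2⟩ := abs_le.mp ht
  have hpos : 0 < 1 - 2 * t := by linarith
  have habs : |2 * t| ≤ 1 / 2 := by rw [abs_mul, abs_two]; linarith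
  have hlog := Real.abs_log_sub_add_sum_range_le (x := 2 * t) (by linarith) 1
  simp only [Finset.sum_range_one, zero_add, pow_one, Nat.cast_zero, div_one, Nat.reduceAdd,
    sq_abs] at hlog
  have hbd : (2 * t) ^ 2 / (1 - |2 * t|) ≤ 8 * t ^ 2 := by
    rw [div_le_iff₀ (by linarith)]
    nlinarith [sq_nonneg t]
  have hlow := (abs_le.mp (hlog.trans hbd)).1
  rw [Real.sqrt_eq_rpow, ← Real.rpow_neg hpos.le, Real.rpow_def_of_pos hpos, ← Real.exp_add]
  apply Real.exp_le_exp.mpr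
  linarith

lemma integral_exp_mul_sq_gaussianReal {t : ℝ} (ht : t < 1 / 2) :
    ∫ z, Real.exp (t * z ^ 2) ∂(gaussianReal 0 1) = (√(1 - 2 * t))⁻¹ := by
  have hpos : 0 < 1 - 2 * t := by linarith
  rw [integral_gaussianReal_eq_integral_smul one_ne_zero]
  have : ∀ z : ℝ, gaussianPDFReal 0 1 z • Real.exp (t * z ^ 2)
      = (√(2 * Real.pi))⁻¹ * Real.exp (-((1 - 2 * t) / 2) * z ^ 2) := by
    intro z
    simp only [gaussianPDFReal, NNReal.coe_one, mul_one, sub_zero, smul_eq_mul]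
    rw [mul_assoc, ← Real.exp_add]
    congr 2
    ring
  simp_rw [this]
  rw [integral_const_mul, integral_gaussian, ← Real.sqrt_inv, ← Real.sqrt_inv, ← Real.sqrt_mul
    (by positivity)]
  congr 1
  field_simp

lemma integral_exp_mul_centered_sq_le {t : ℝ} (ht : |t| ≤ 1 / 4) :
    ∫ z, Real.exp (t * (z ^ 2 - 1)) ∂(gaussianReal 0 1) ≤ Real.exp (4 * t ^ 2) := by
  have : ∀ z : ℝ, Real.exp (t * (z ^ 2 - 1)) = Real.exp (-t) * Real.exp (t * z ^ 2) := by
    intro z; rw [← Real.exp_add]; congr 1; ring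
  simp_rw [this]
  rw [integral_const_mul, integral_exp_mul_sq_gaussianReal (by linarith [(abs_le.mp ht).2])]
  exact exp_neg_div_sqrt_le ht

/-- The integral of a non-integrable function is `0` by convention, while the closed form for the
exponential moment is positive; this forces integrability. -/
lemma integrable_exp_mul_centered_sq {t : ℝ} (ht : |t| ≤ 1 / 4) :
    Integrable (fun z => Real.exp (t * (z ^ 2 - 1))) (gaussianReal 0 1) := by
  have h2 := (abs_le.mp ht).2
  have h : Integrable (fun z : ℝ => Real.exp (t * z ^ 2)) (gaussianReal 0 1) := by
    by_contra hni
    have := integral_exp_mul_sq_gaussianReal (t := t) (by linarith)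
    rw [integral_undef hni] at this
    have : 0 < (√(1 - 2 * t))⁻¹ := by
      have : 0 < 1 - 2 * t := by linarith
      positivity
    linarith
  have h' := h.const_mul (Real.exp (-t))
  convert h' using 2 with z
  rw [← Real.exp_add]; congr 1; ring

variable {ι : Type*} [Fintype ι]

/-- Chernoff's bound: by independence the moment generating function is a product of one-dimensional
ones. -/
lemma gaussian_diag_upper_tail (l : ι → ℝ) {t : ℝ} (ht0 : 0 ≤ t) (ht : ∀ k, t * |l k| ≤ 1 / 4)
    (x : ℝ) :
    (Measure.pi fun _ : ι => gaussianReal 0 1).real {z | x ≤ ∑ k, l k * (z k ^ 2 - 1)}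
      ≤ Real.exp (-t * x + 4 * t ^ 2 * ∑ k, l k ^ 2) := by
  have habs : ∀ k, |t * l k| ≤ 1 / 4 := fun k => by rw [abs_mul, abs_of_nonneg ht0]; exact ht k
  have hprod : ∀ z : ι → ℝ, Real.exp (t * ∑ k, l k * (z k ^ 2 - 1))
      = ∏ k, Real.exp ((t * l k) * (z k ^ 2 - 1)) := by
    intro z
    rw [← Real.exp_sum, Finset.mul_sum]
    simp_rw [mul_assoc]
  have hint : Integrable (fun z : ι → ℝ => Real.exp (t * ∑ k, l k * (z k ^ 2 - 1)))
      (Measure.pi fun _ : ι => gaussianReal 0 1) := by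
    simp_rw [hprod]
    exact Integrable.fintype_prod (f := fun k z => Real.exp ((t * l k) * (z ^ 2 - 1)))
      fun k => integrable_exp_mul_centered_sq (habs k)
  refine (measure_ge_le_exp_mul_mgf x ht0 hint).trans ?_
  rw [Real.exp_add]
  refine mul_le_mul_of_nonneg_left ?_ (Real.exp_pos _).le
  rw [mgf]
  simp_rw [hprod]
  rw [integral_fintype_prod_eq_prod (fun k (z : ℝ) => Real.exp ((t * l k) * (z ^ 2 - 1))),
    Finset.mul_sum, Real.exp_sum]
  refine Finset.prod_le_prod (fun k _ => integral_nonneg fun z => (Real.exp_pos _).le) fun k _ => ?_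
  refine (integral_exp_mul_centered_sq_le (habs k)).trans (le_of_eq ?_)
  congr 1; ring

lemma gaussian_diag_tail_std (l : ι → ℝ) {t : ℝ} (ht0 : 0 ≤ t) (ht : ∀ k, t * |l k| ≤ 1 / 4)
    (x : ℝ) :
    (Measure.pi fun _ : ι => gaussianReal 0 1).real {z | x ≤ |∑ k, l k * (z k ^ 2 - 1)|}
      ≤ 2 * Real.exp (-t * x + 4 * t ^ 2 * ∑ k, l k ^ 2) := by
  have h1 := gaussian_diag_upper_tail l ht0 ht x
  have h2 := gaussian_diag_upper_tail (fun k => - l k) ht0 (by simpa using ht) x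
  simp only [neg_mul, Finset.sum_neg_distrib, even_two, Even.neg_pow] at h2
  have hsub : {z : ι → ℝ | x ≤ |∑ k, l k * (z k ^ 2 - 1)|} ⊆
      {z | x ≤ ∑ k, l k * (z k ^ 2 - 1)} ∪ {z | x ≤ -∑ k, l k * (z k ^ 2 - 1)} := fun z hz => by
    rcases le_abs.mp (show x ≤ |_| from hz) with h | h
    · exact Or.inl h
    · exact Or.inr h
  exact (measureReal_mono hsub).trans
    ((measureReal_union_le _ _).trans (by simpa [two_mul] using add_le_add h1 h2))

lemma measurePreserving_sqrt_mul_gaussianReal (v : ℝ≥0) :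
    MeasurePreserving (fun z => √(v : ℝ) * z) (gaussianReal 0 1) (gaussianReal 0 v) where
  measurable := by fun_prop
  map_eq := by
    rw [gaussianReal_map_const_mul]
    congr 1
    · simp
    · ext; simp

lemma measurePreserving_sqrt_mul_pi_gaussianReal (v : ℝ≥0) :
    MeasurePreserving (fun (z : ι → ℝ) k => √(v : ℝ) * z k)
      (Measure.pi fun _ : ι => gaussianReal 0 1) (Measure.pi fun _ : ι => gaussianReal 0 v) :=
  measurePreserving_pi _ _ fun _ => measurePreserving_sqrt_mul_gaussianReal v

lemma real_eq_of_measurePreserving {α β : Type*} [MeasurableSpace α] [MeasurableSpace β]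
    {μ : Measure α} {ν : Measure β} {f : α → β} (hf : MeasurePreserving f μ ν) {s : Set β}
    (hs : MeasurableSet s) : ν.real s = μ.real (f ⁻¹' s) := by
  rw [measureReal_def, measureReal_def, hf.measure_preimage hs.nullMeasurableSet]

/-- The event is strict so that `v = 0` is covered: it then reads `0 < 0`. -/
lemma gaussian_diag_tail (v : ℝ≥0) (l : ι → ℝ) {t : ℝ} (ht0 : 0 ≤ t)
    (ht : ∀ k, t * |l k| ≤ 1 / 4) (x : ℝ) :
    (Measure.pi fun _ : ι => gaussianReal 0 v).real {z | v * x < |∑ k, l k * (z k ^ 2 - v)|}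
      ≤ 2 * Real.exp (-t * x + 4 * t ^ 2 * ∑ k, l k ^ 2) := by
  rw [real_eq_of_measurePreserving (measurePreserving_sqrt_mul_pi_gaussianReal v)
    (measurableSet_lt (by fun_prop) (by fun_prop))]
  refine (measureReal_mono fun z hz => ?_).trans (gaussian_diag_tail_std l ht0 ht x)
  have hz' : v * x < |∑ k, l k * ((√(v : ℝ) * z k) ^ 2 - v)| := hz
  have : ∑ k, l k * ((√(v : ℝ) * z k) ^ 2 - v) = v * ∑ k, l k * (z k ^ 2 - 1) := by
    rw [Finset.mul_sum]
    refine Finset.sum_congr rfl fun k _ => ?_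
    rw [mul_pow, Real.sq_sqrt v.coe_nonneg]; ring
  rw [this, abs_mul, abs_of_nonneg v.coe_nonneg] at hz'
  exact (lt_of_mul_lt_mul_left hz' v.coe_nonneg).le

/-! ### Diagonalization of symmetric quadratic forms -/

variable [DecidableEq ι]

lemma sum_eigenvalues_sq {M : Matrix ι ι ℝ} (hM : M.IsHermitian) :
    ∑ k, hM.eigenvalues k ^ 2 = ∑ i, ∑ j, M i j ^ 2 := by
  have h1 : (M * M).trace = ∑ i, ∑ j, M i j ^ 2 := by
    simp only [Matrix.trace, Matrix.diag, Matrix.mul_apply]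
    refine Finset.sum_congr rfl fun i _ => Finset.sum_congr rfl fun j _ => ?_
    have := hM.apply i j
    simp only [star_trivial] at this
    rw [this, sq]
  rw [← h1]
  conv_rhs => rw [hM.spectral_theorem, ← map_mul, Matrix.diagonal_mul_diagonal]
  simp only [Unitary.conjStarAlgAut_apply]
  rw [Matrix.trace_mul_cycle, Unitary.coe_star_mul_self, one_mul, Matrix.trace_diagonal]
  simp [sq]

lemma quadForm_eigenvectorBasis {M : Matrix ι ι ℝ} (hM : M.IsHermitian) (w : ι → ℝ) :
    (∑ k, w k • hM.eigenvectorBasis k).ofLp ⬝ᵥ M *ᵥ (∑ k, w k • hM.eigenvectorBasis k).ofLp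
      = ∑ k, hM.eigenvalues k * w k ^ 2 := by
  have h1 : M *ᵥ (∑ k, w k • hM.eigenvectorBasis k).ofLp
      = (∑ k, (hM.eigenvalues k * w k) • hM.eigenvectorBasis k).ofLp := by
    simp only [WithLp.ofLp_sum, WithLp.ofLp_smul, Matrix.mulVec_sum, Matrix.mulVec_smul,
      hM.mulVec_eigenvectorBasis, smul_smul, mul_comm]
  rw [h1]
  have h2 : ∀ x y : EuclideanSpace ℝ ι, x.ofLp ⬝ᵥ y.ofLp = inner ℝ x y := by
    intro x y
    simp [PiLp.inner_apply, dotProduct, mul_comm]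
  rw [h2, hM.eigenvectorBasis.orthonormal.inner_sum]
  simp only [conj_trivial]
  exact Finset.sum_congr rfl fun k _ => by ring

/-- A Hanson–Wright type bound for symmetric matrices of zero trace. -/
lemma gaussian_quadForm_tail (v : ℝ≥0) {M : Matrix ι ι ℝ} (hM : M.IsHermitian)
    (htr : M.trace = 0) {t : ℝ} (ht0 : 0 ≤ t) (ht : t * √(∑ i, ∑ j, M i j ^ 2) ≤ 1 / 4) (x : ℝ) :
    (Measure.pi fun _ : ι => gaussianReal 0 v).real {z | v * x < |z ⬝ᵥ M *ᵥ z|}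
      ≤ 2 * Real.exp (-t * x + 4 * t ^ 2 * ∑ i, ∑ j, M i j ^ 2) := by
  have hlam : ∀ k, t * |hM.eigenvalues k| ≤ 1 / 4 := by
    intro k
    refine (mul_le_mul_of_nonneg_left ?_ ht0).trans ht
    rw [← sum_eigenvalues_sq hM]
    refine Real.abs_le_sqrt ?_
    exact Finset.single_le_sum (f := fun k => hM.eigenvalues k ^ 2) (fun _ _ => sq_nonneg _)
      (Finset.mem_univ k)
  have htr' : ∑ k, hM.eigenvalues k = 0 := by
    rw [hM.trace_eq_sum_eigenvalues] at htr
    exact_mod_cast htr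
  have hq : Measurable fun x : EuclideanSpace ℝ ι => x.ofLp ⬝ᵥ M *ᵥ x.ofLp := by
    unfold dotProduct Matrix.mulVec dotProduct
    fun_prop
  have hq' : Measurable fun x : ι → ℝ => x ⬝ᵥ M *ᵥ x := by
    unfold dotProduct Matrix.mulVec dotProduct
    fun_prop
  have hstd : (Measure.pi fun _ : ι => gaussianReal 0 1).real {z | x ≤ |z ⬝ᵥ M *ᵥ z|}
      ≤ 2 * Real.exp (-t * x + 4 * t ^ 2 * ∑ i, ∑ j, M i j ^ 2) := by
    -- The standard Gaussian has i.i.d. coordinates both in the canonical basis and in the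
    -- eigenbasis of `M`, so the form has the law of `∑ λₖ wₖ²`. Zero trace then allows each `wₖ²`
    -- to be centred for free.
    have e1 : MeasurePreserving (WithLp.toLp 2) (Measure.pi fun _ : ι => gaussianReal 0 1)
        (stdGaussian (EuclideanSpace ℝ ι)) := ⟨by fun_prop, map_pi_eq_stdGaussian⟩
    have e2 : MeasurePreserving (fun w : ι → ℝ => ∑ k, w k • hM.eigenvectorBasis k)
        (Measure.pi fun _ : ι => gaussianReal 0 1) (stdGaussian (EuclideanSpace ℝ ι)) :=
      ⟨by fun_prop, (stdGaussian_eq_map_pi_orthonormalBasis _).symm⟩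
    have hs : MeasurableSet {y : EuclideanSpace ℝ ι | x ≤ |y.ofLp ⬝ᵥ M *ᵥ y.ofLp|} :=
      measurableSet_le measurable_const (by fun_prop)
    have := (real_eq_of_measurePreserving e1 hs).symm.trans (real_eq_of_measurePreserving e2 hs)
    simp only [Set.preimage_ofPred_eq, quadForm_eigenvectorBasis] at this
    rw [this, ← sum_eigenvalues_sq hM]
    have h := gaussian_diag_tail_std hM.eigenvalues ht0 hlam x
    simpa [mul_sub, Finset.sum_sub_distrib, htr'] using h
  rw [real_eq_of_measurePreserving (measurePreserving_sqrt_mul_pi_gaussianReal v)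
    (measurableSet_lt (by fun_prop) (by fun_prop))]
  refine (measureReal_mono fun z hz => ?_).trans hstd
  have hz' : v * x < |(√(v : ℝ) • z) ⬝ᵥ M *ᵥ (√(v : ℝ) • z)| := hz
  rw [Matrix.mulVec_smul, smul_dotProduct, dotProduct_smul, smul_smul, Real.mul_self_sqrt v.coe_nonneg,
    smul_eq_mul, abs_mul, abs_of_nonneg v.coe_nonneg] at hz'
  exact (lt_of_mul_lt_mul_left hz' v.coe_nonneg).le

end

section

/-! ### Laws of linear images of Gaussian vectors and matrices -/

/-- Compared through characteristic functions, which factor over the coordinates. -/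
lemma measurePreserving_dotProduct_gaussian {ι : Type*} [Fintype ι] (v : ℝ≥0) (b : ι → ℝ) :
    MeasurePreserving (fun x : ι → ℝ => b ⬝ᵥ x) (Measure.pi fun _ : ι => gaussianReal 0 v)
      (gaussianReal 0 ((b ⬝ᵥ b).toNNReal * v)) := by
  have hm : Measurable fun x : ι → ℝ => b ⬝ᵥ x := by unfold dotProduct; fun_prop
  refine ⟨hm, ?_⟩
  have := Measure.isProbabilityMeasure_map (μ := Measure.pi fun _ : ι => gaussianReal 0 v)
    hm.aemeasurable
  refine Measure.ext_of_charFun ?_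
  ext t
  have hbb : 0 ≤ b ⬝ᵥ b := by
    unfold dotProduct; exact Finset.sum_nonneg fun i _ => mul_self_nonneg _
  rw [charFun_apply_real, integral_map hm.aemeasurable (by fun_prop)]
  have : ∀ x : ι → ℝ, Complex.exp (t * ((b ⬝ᵥ x : ℝ) : ℂ) * Complex.I)
      = ∏ i, Complex.exp (((t * b i : ℝ) : ℂ) * (x i : ℂ) * Complex.I) := by
    intro x
    rw [← Complex.exp_sum]
    congr 1
    simp only [dotProduct, Complex.ofReal_sum, Complex.ofReal_mul, Finset.mul_sum, Finset.sum_mul,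
      mul_assoc]
  simp_rw [this]
  rw [integral_fintype_prod_eq_prod
    (fun i (x : ℝ) => Complex.exp (((t * b i : ℝ) : ℂ) * (x : ℂ) * Complex.I))]
  simp_rw [← charFun_apply_real, charFun_gaussianReal]
  rw [← Complex.exp_sum]
  congr 1
  simp only [NNReal.coe_mul, Real.coe_toNNReal _ hbb]
  simp only [dotProduct]
  push_cast
  simp only [mul_zero, zero_mul, zero_sub, Finset.sum_mul, Finset.sum_div, Finset.sum_neg_distrib]
  congr 1
  exact Finset.sum_congr rfl fun i _ => by ring

lemma measurePreserving_swap_pi {ι κ α : Type*} [Fintype ι] [Fintype κ] [MeasurableSpace α]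
    (μ : Measure α) [IsProbabilityMeasure μ] :
    MeasurePreserving (fun (A : ι → κ → α) k i => A i k)
      (Measure.pi fun _ : ι => Measure.pi fun _ : κ => μ)
      (Measure.pi fun _ : κ => Measure.pi fun _ : ι => μ) := by
  have hm : Measurable (fun (A : ι → κ → α) k i => A i k) := by fun_prop
  refine ⟨hm, Eq.symm ?_⟩
  -- It is enough to compare the two measures on boxes whose sides are themselves boxes; there both
  -- are the same double product.
  refine Measure.pi_eq_generateFrom (fun _ => generateFrom_pi) (fun _ => isPiSystem_pi)
    (fun _ => Measure.FiniteSpanningSetsIn.pi fun _ => μ.toFiniteSpanningSetsIn) ?_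
  intro s hs
  choose u hu using hs
  have hus : s = fun k => Set.univ.pi (u k) := funext fun k => (hu k).2.symm
  have humeas : ∀ k i, MeasurableSet (u k i) := fun k i => (hu k).1 i (Set.mem_univ i)
  subst hus
  rw [Measure.map_apply hm (MeasurableSet.univ_pi fun k => MeasurableSet.univ_pi (humeas k))]
  have : (fun (A : ι → κ → α) k i => A i k) ⁻¹' Set.univ.pi (fun k => Set.univ.pi (u k))
      = Set.univ.pi fun i => Set.univ.pi fun k => u k i := by
    ext A; simp only [Set.mem_preimage, Set.mem_univ_pi]; exact forall_comm
  rw [this]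
  simp_rw [Measure.pi_pi]
  exact Finset.prod_comm

lemma measurePreserving_mulVec_gaussian {ι κ : Type*} [Fintype ι] [Fintype κ] (v : ℝ≥0)
    (c : κ → ℝ) :
    MeasurePreserving (fun A : ι → κ → ℝ => Matrix.of A *ᵥ c)
      (Measure.pi fun _ : ι => Measure.pi fun _ : κ => gaussianReal 0 v)
      (Measure.pi fun _ : ι => gaussianReal 0 ((c ⬝ᵥ c).toNNReal * v)) := by
  convert measurePreserving_pi (fun _ : ι => Measure.pi fun _ : κ => gaussianReal 0 v) _
    (fun _ => measurePreserving_dotProduct_gaussian v c) using 1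
  ext A i
  exact dotProduct_comm _ _

lemma measurePreserving_vecMul_gaussian {ι κ : Type*} [Fintype ι] [Fintype κ] (v : ℝ≥0)
    (b : ι → ℝ) :
    MeasurePreserving (fun A : ι → κ → ℝ => b ᵥ* Matrix.of A)
      (Measure.pi fun _ : ι => Measure.pi fun _ : κ => gaussianReal 0 v)
      (Measure.pi fun _ : κ => gaussianReal 0 ((b ⬝ᵥ b).toNNReal * v)) :=
  (measurePreserving_pi (fun _ : κ => Measure.pi fun _ : ι => gaussianReal 0 v) _
    (fun _ => measurePreserving_dotProduct_gaussian v b)).comp (measurePreserving_swap_pi _)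

/-- Coordinatewise maps of a pair of independent families. -/
lemma measurePreserving_pi_prod {ι α β γ : Type*} [Fintype ι] [MeasurableSpace α]
    [MeasurableSpace β] [MeasurableSpace γ] {μ : ι → Measure α} {ν : ι → Measure β}
    {ρ : ι → Measure γ}
    [∀ i, SigmaFinite (μ i)] [∀ i, SigmaFinite (ν i)] [∀ i, SigmaFinite (ρ i)]
    {f : ι → α × β → γ} (hf : ∀ i, MeasurePreserving (f i) ((μ i).prod (ν i)) (ρ i)) :
    MeasurePreserving (fun q : (ι → α) × (ι → β) => fun i => f i (q.1 i, q.2 i))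
      ((Measure.pi μ).prod (Measure.pi ν)) (Measure.pi ρ) :=
  (measurePreserving_pi _ _ hf).comp
    ((measurePreserving_arrowProdEquivProdArrow α β ι μ ν).symm _)

/-- Replacing the columns outside `T` by those of an independent copy preserves the law of a
matrix with i.i.d. entries. -/
lemma measurePreserving_resample {ι κ : Type*} [Fintype ι] [Fintype κ] [DecidableEq κ]
    (μ : Measure ℝ) [IsProbabilityMeasure μ] (T : Finset κ) :
    MeasurePreserving
      (fun q : (ι → κ → ℝ) × (ι → κ → ℝ) => fun i k => if k ∈ T then q.1 i k else q.2 i k)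
      ((Measure.pi fun _ : ι => Measure.pi fun _ : κ => μ).prod
        (Measure.pi fun _ : ι => Measure.pi fun _ : κ => μ))
      (Measure.pi fun _ : ι => Measure.pi fun _ : κ => μ) := by
  refine measurePreserving_pi_prod
    (f := fun _ (q : (κ → ℝ) × (κ → ℝ)) k => if k ∈ T then q.1 k else q.2 k) fun _ => ?_
  refine measurePreserving_pi_prod (f := fun k (q : ℝ × ℝ) => if k ∈ T then q.1 else q.2) fun k => ?_
  by_cases hk : k ∈ T
  · simpa [hk] using measurePreserving_fst (μ := μ) (ν := μ)
  · simpa [hk] using measurePreserving_snd (μ := μ) (ν := μ)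

/-- A continuous linear image of a Gaussian measure is Gaussian, so only mean and variance need
identifying. -/
lemma measurePreserving_dotProduct_multivariateGaussian {ι : Type*} [Fintype ι] [DecidableEq ι]
    {S : Matrix ι ι ℝ} (hS : S.PosSemidef) (c : ι → ℝ) :
    MeasurePreserving (fun x : EuclideanSpace ℝ ι => c ⬝ᵥ x.ofLp) (multivariateGaussian 0 S)
      (gaussianReal 0 (c ⬝ᵥ S *ᵥ c).toNNReal) := by
  have hc : (fun x : EuclideanSpace ℝ ι => c ⬝ᵥ x.ofLp) = innerSL ℝ (WithLp.toLp 2 c) := by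
    ext x
    simp [PiLp.inner_apply, dotProduct, mul_comm]
  refine ⟨by rw [hc]; fun_prop, ?_⟩
  rw [hc, IsGaussian.map_eq_gaussianReal, ContinuousLinearMap.integral_comp_id_comm]
  · congr 1
    · simp
    · congr 1
      rw [← covariance_self (by fun_prop)]
      have := covarianceBilin_apply_eq_cov (μ := multivariateGaussian 0 S)
        (IsGaussian.memLp_two_id) (WithLp.toLp 2 c) (WithLp.toLp 2 c)
      rw [covarianceBilin_multivariateGaussian hS] at this
      exact this.symm
  · exact IsGaussian.integrable_id

lemma measurePreserving_add_gaussianReal (u v : ℝ≥0) :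
    MeasurePreserving (fun q : ℝ × ℝ => q.1 + q.2) ((gaussianReal 0 u).prod (gaussianReal 0 v))
      (gaussianReal 0 (u + v)) := by
  refine ⟨by fun_prop, ?_⟩
  have := gaussianReal_conv_gaussianReal (m₁ := 0) (m₂ := 0) (v₁ := u) (v₂ := v)
  simpa [Measure.conv] using this

/-- The law of a linear functional of the observations for a fixed sensing matrix. -/
lemma measurePreserving_dotProduct_obs {n d p : ℕ} {S : Matrix (Fin p) (Fin p) ℝ}
    (hS : S.PosSemidef) (σ : ℝ≥0) (A : Fin d → Fin p → ℝ) (b : Fin d → ℝ) :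
    MeasurePreserving
      (fun q : (Fin n → EuclideanSpace ℝ (Fin p)) × (Fin n → Fin d → ℝ) =>
        fun s => b ⬝ᵥ obs A q.1 q.2 s)
      ((Measure.pi fun _ : Fin n => multivariateGaussian 0 S).prod
        (Measure.pi fun _ : Fin n => Measure.pi fun _ : Fin d => gaussianReal 0 (σ ^ 2)))
      (Measure.pi fun _ : Fin n => gaussianReal 0
        (((b ᵥ* Matrix.of A) ⬝ᵥ S *ᵥ (b ᵥ* Matrix.of A)).toNNReal
          + (b ⬝ᵥ b).toNNReal * σ ^ 2)) := by
  have h1 : MeasurePreserving (fun q : EuclideanSpace ℝ (Fin p) × (Fin d → ℝ) =>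
      (b ᵥ* Matrix.of A) ⬝ᵥ q.1.ofLp + b ⬝ᵥ q.2)
      ((multivariateGaussian 0 S).prod (Measure.pi fun _ : Fin d => gaussianReal 0 (σ ^ 2)))
      (gaussianReal 0 (((b ᵥ* Matrix.of A) ⬝ᵥ S *ᵥ (b ᵥ* Matrix.of A)).toNNReal
          + (b ⬝ᵥ b).toNNReal * σ ^ 2)) :=
    (measurePreserving_add_gaussianReal _ _).comp
      ((measurePreserving_dotProduct_multivariateGaussian hS _).prod
        (measurePreserving_dotProduct_gaussian (σ ^ 2) b))
  convert measurePreserving_pi_prod (ι := Fin n) (fun _ => h1) using 1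
  ext q s
  simp only [obs, dotProduct_add, Matrix.dotProduct_mulVec]

/-- A conditional tail bound integrates to an unconditional one. -/
lemma prod_real_le_of_forall {α β : Type*} [MeasurableSpace α] [MeasurableSpace β]
    {μ : Measure α} {ν : Measure β} [IsProbabilityMeasure μ] [IsProbabilityMeasure ν]
    {s : Set (α × β)} (hs : MeasurableSet s) {δ : ℝ}
    (h : ∀ x, ν.real (Prod.mk x ⁻¹' s) ≤ δ) : (μ.prod ν).real s ≤ δ := by
  have hδ : 0 ≤ δ := by
    obtain ⟨x⟩ := μ.nonempty_of_neZero
    exact measureReal_nonneg.trans (h x)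
  rw [measureReal_def, Measure.prod_apply hs]
  refine ENNReal.toReal_le_of_le_ofReal hδ ?_
  calc ∫⁻ x, ν (Prod.mk x ⁻¹' s) ∂μ ≤ ∫⁻ _, ENNReal.ofReal δ ∂μ := by
        refine lintegral_mono fun x => ?_
        rw [← ENNReal.ofReal_toReal (measure_ne_top ν (Prod.mk x ⁻¹' s))]
        exact ENNReal.ofReal_le_ofReal (h x)
    _ = ENNReal.ofReal δ := by simp

end

section

/-! ### Tail bounds at logarithmic levels -/

lemma gaussian_diag_tail_log {ι : Type*} [Fintype ι] (v : ℝ≥0) {l : ι → ℝ} (hl : ∀ k, |l k| ≤ 1)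
    {N L K : ℝ} (hN : 0 < N) (hcard : (Fintype.card ι : ℝ) ≤ N) (hL : 0 ≤ L) (hK : 0 ≤ K)
    (hLN : L ≤ K * N) :
    (Measure.pi fun _ : ι => gaussianReal 0 v).real
        {z | v * (20 * (1 + K) * √(N * L)) < |∑ k, l k * (z k ^ 2 - v)|}
      ≤ 2 * Real.exp (-(4 * L)) := by
  -- With this `t` the linear term of the exponent is `-5L` and the quadratic one at most `L`,
  -- leaving `-4L`. The factor `1 + K` keeps `t ≤ 1/4`.
  set t : ℝ := √(L / N) / (4 * (1 + K)) with ht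
  have ht0 : 0 ≤ t := by positivity
  have hsq : √(L / N) ≤ 1 + K := by
    refine Real.sqrt_le_iff.mpr ⟨by positivity, ?_⟩
    rw [div_le_iff₀ hN]
    nlinarith
  have ht4 : t ≤ 1 / 4 := by
    rw [ht, div_le_iff₀ (by positivity)]
    linarith
  have hlt : ∀ k, t * |l k| ≤ 1 / 4 := fun k =>
    (mul_le_of_le_one_right ht0 (hl k)).trans ht4
  refine (gaussian_diag_tail v l ht0 hlt _).trans ?_
  refine mul_le_mul_of_nonneg_left (Real.exp_le_exp.mpr ?_) zero_le_two
  have h1 : t * (20 * (1 + K) * √(N * L)) = 5 * L := by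
    have : √(L / N) * √(N * L) = L := by
      rw [← Real.sqrt_mul (by positivity), show L / N * (N * L) = L ^ 2 by field_simp,
        Real.sqrt_sq hL]
    rw [ht, div_mul_eq_mul_div, div_eq_iff (by positivity)]
    linear_combination 20 * (1 + K) * this
  have h2 : ∑ k, l k ^ 2 ≤ N := by
    refine le_trans ?_ hcard
    calc ∑ k, l k ^ 2 ≤ ∑ _k : ι, (1 : ℝ) :=
          Finset.sum_le_sum fun k _ => (sq_le_one_iff_abs_le_one _).mpr (hl k)
      _ = Fintype.card ι := by simp
  have h3 : 4 * t ^ 2 * N ≤ L := by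
    have : t ^ 2 * N = L / (16 * (1 + K) ^ 2) := by
      rw [ht, div_pow, Real.sq_sqrt (by positivity)]
      field_simp
      ring
    have h5 : L / (16 * (1 + K) ^ 2) ≤ L / 4 :=
      div_le_div_of_nonneg_left hL (by norm_num) (by nlinarith)
    linarith
  have h4 : 4 * t ^ 2 * ∑ k, l k ^ 2 ≤ 4 * t ^ 2 * N :=
    mul_le_mul_of_nonneg_left h2 (by positivity)
  linarith

lemma gaussian_quadForm_tail_log {ι : Type*} [Fintype ι] [DecidableEq ι] (v : ℝ≥0)
    {M : Matrix ι ι ℝ} (hM : M.IsHermitian) (htr : M.trace = 0) {F L : ℝ}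
    (hF : √(∑ i, ∑ j, M i j ^ 2) ≤ F) (hL : 1 ≤ L) :
    (Measure.pi fun _ : ι => gaussianReal 0 v).real {z | v * (20 * L * F) < |z ⬝ᵥ M *ᵥ z|}
      ≤ 2 * Real.exp (-(4 * L)) := by
  have hF0 : 0 ≤ F := (Real.sqrt_nonneg _).trans hF
  have hsum0 : 0 ≤ ∑ i, ∑ j, M i j ^ 2 :=
    Finset.sum_nonneg fun i _ => Finset.sum_nonneg fun j _ => sq_nonneg _
  rcases hF0.eq_or_lt with h0 | hpos
  · have hz : ∑ i, ∑ j, M i j ^ 2 = 0 := by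
      rw [← h0] at hF
      exact (Real.sqrt_eq_zero hsum0).mp (le_antisymm hF (Real.sqrt_nonneg _))
    have hM0 : M = 0 := by
      ext i j
      have h1 := (Finset.sum_eq_zero_iff_of_nonneg
        (fun i _ => Finset.sum_nonneg fun j _ => sq_nonneg (M i j))).mp hz i (Finset.mem_univ i)
      have h2 := (Finset.sum_eq_zero_iff_of_nonneg fun j _ => sq_nonneg (M i j)).mp h1 j
        (Finset.mem_univ j)
      simpa using h2
    subst hM0
    simp only [← h0, mul_zero, Matrix.zero_mulVec, dotProduct_zero, abs_zero, lt_irrefl]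
    simp only [Set.ofPred_false, measureReal_empty]
    positivity
  -- For `t = 1/(4F)` the linear term is `-5L` and the quadratic one at most `1/4 ≤ L`.
  · have ht : 1 / (4 * F) * √(∑ i, ∑ j, M i j ^ 2) ≤ 1 / 4 := by
      calc 1 / (4 * F) * √(∑ i, ∑ j, M i j ^ 2) ≤ 1 / (4 * F) * F := by gcongr
        _ = 1 / 4 := by field_simp
    refine (gaussian_quadForm_tail v hM htr (by positivity) ht _).trans ?_
    refine mul_le_mul_of_nonneg_left (Real.exp_le_exp.mpr ?_) zero_le_two
    have h1 : ∑ i, ∑ j, M i j ^ 2 ≤ F ^ 2 := (Real.sqrt_le_left hF0).mp hF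
    have h2 : 4 * (1 / (4 * F)) ^ 2 * ∑ i, ∑ j, M i j ^ 2 ≤ 4 * (1 / (4 * F)) ^ 2 * F ^ 2 := by
      gcongr
    have h3 : 4 * (1 / (4 * F)) ^ 2 * F ^ 2 = 1 / 4 := by field_simp
    have h4 : -(1 / (4 * F)) * (20 * L * F) = -(5 * L) := by field_simp; ring
    linarith

/-! ### The sensing matrix -/

/-- The law of the sensing matrix. -/
noncomputable abbrev sensingLaw (d p : ℕ) : Measure (Fin d → Fin p → ℝ) :=
  Measure.pi fun _ : Fin d => Measure.pi fun _ : Fin p => gaussianReal 0 ((d : ℝ≥0)⁻¹)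

lemma dotProduct_self_nonneg' {ι : Type*} [Fintype ι] (x : ι → ℝ) : 0 ≤ x ⬝ᵥ x :=
  Finset.sum_nonneg fun _ _ => mul_self_nonneg _

lemma measurable_dotProduct {ι α : Type*} [Fintype ι] [MeasurableSpace α] {f g : α → ι → ℝ}
    (hf : Measurable f) (hg : Measurable g) : Measurable fun a => f a ⬝ᵥ g a := by
  unfold dotProduct; fun_prop

lemma measurable_mulVec {ι κ α : Type*} [Fintype κ] [MeasurableSpace α]
    {f : α → ι → κ → ℝ} {g : α → κ → ℝ}
    (hf : Measurable f) (hg : Measurable g) : Measurable fun a => Matrix.of (f a) *ᵥ g a :=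
  measurable_pi_iff.mpr fun i => measurable_dotProduct ((measurable_pi_apply i).comp hf) hg

lemma measurable_vecMul {ι κ α : Type*} [Fintype ι] [MeasurableSpace α]
    {f : α → ι → κ → ℝ} {g : α → ι → ℝ}
    (hf : Measurable f) (hg : Measurable g) : Measurable fun a => g a ᵥ* Matrix.of (f a) :=
  measurable_pi_iff.mpr fun i => measurable_dotProduct hg
    (measurable_pi_iff.mpr fun j => by simp only [Matrix.of_apply]; fun_prop)

variable {d p : ℕ} {L : ℝ}

/-- The entries of `A c` are i.i.d. of variance `|c|²/d`. The constant is `40 = 20(1 + K)` with `K =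
1`, as `L ≤ d`. -/
lemma sensing_norm_tail (hd : 0 < d) (hL : 0 ≤ L) (hLd : L ≤ d) (c : Fin p → ℝ) :
    (sensingLaw d p).real {A | 40 * √(L / d) * (c ⬝ᵥ c) <
        |(Matrix.of A *ᵥ c) ⬝ᵥ (Matrix.of A *ᵥ c) - c ⬝ᵥ c|} ≤ 2 * Real.exp (-(4 * L)) := by
  have hd' : (0 : ℝ) < d := Nat.cast_pos.mpr hd
  have hmp := measurePreserving_mulVec_gaussian (ι := Fin d) ((d : ℝ≥0)⁻¹) c
  have h := gaussian_diag_tail_log (ι := Fin d) ((c ⬝ᵥ c).toNNReal * (d : ℝ≥0)⁻¹)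
    (l := fun _ => 1) (by simp) hd' (by simp) hL zero_le_one (by simpa using hLd)
  rw [real_eq_of_measurePreserving hmp (measurableSet_lt (by fun_prop) (by fun_prop))] at h
  refine (measureReal_mono fun A hA => ?_).trans h
  have hsq : (d : ℝ)⁻¹ * √(d * L) = √(L / d) := by
    rw [show (d : ℝ) * L = d ^ 2 * (L / d) by field_simp, Real.sqrt_mul (by positivity),
      Real.sqrt_sq hd'.le]
    field_simp
  have hsum : ∑ r, (1 : ℝ) * ((Matrix.of A *ᵥ c) r ^ 2 - (c ⬝ᵥ c) * (d : ℝ)⁻¹)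
      = (Matrix.of A *ᵥ c) ⬝ᵥ (Matrix.of A *ᵥ c) - c ⬝ᵥ c := by
    simp only [one_mul, Finset.sum_sub_distrib, Finset.sum_const, Finset.card_univ,
      Fintype.card_fin, nsmul_eq_mul]
    rw [show (d : ℝ) * (c ⬝ᵥ c * (d : ℝ)⁻¹) = c ⬝ᵥ c by field_simp]
    simp only [dotProduct, sq]
  have hA' : 40 * √(L / d) * (c ⬝ᵥ c) <
        |(Matrix.of A *ᵥ c) ⬝ᵥ (Matrix.of A *ᵥ c) - c ⬝ᵥ c| := hA
  change (((c ⬝ᵥ c).toNNReal * (d : ℝ≥0)⁻¹ : ℝ≥0) : ℝ) * (20 * (1 + 1) * √(d * L)) <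
    |∑ r, (1 : ℝ) * ((Matrix.of A *ᵥ c) r ^ 2 - (((c ⬝ᵥ c).toNNReal * (d : ℝ≥0)⁻¹ : ℝ≥0) : ℝ))|
  simp only [NNReal.coe_mul, Real.coe_toNNReal _ (dotProduct_self_nonneg' c), NNReal.coe_inv,
    NNReal.coe_natCast]
  rw [hsum]
  refine lt_of_eq_of_lt ?_ hA'
  rw [← hsq]; ring

/-- Polarization along `x ± y`; the two errors add up to `40√(L/d)(|x+y|² + |x-y|²) ≤ 4 · 40√(L/d)`.
-/
lemma sensing_inner_tail_unit (hd : 0 < d) (hL : 0 ≤ L) (hLd : L ≤ d) {x y : Fin p → ℝ}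
    (hx : x ⬝ᵥ x ≤ 1) (hy : y ⬝ᵥ y ≤ 1) :
    (sensingLaw d p).real {A | 40 * √(L / d) <
        |(Matrix.of A *ᵥ x) ⬝ᵥ (Matrix.of A *ᵥ y) - x ⬝ᵥ y|} ≤ 4 * Real.exp (-(4 * L)) := by
  set J : (Fin p → ℝ) → Set (Fin d → Fin p → ℝ) := fun c => {A | 40 * √(L / d) * (c ⬝ᵥ c) <
        |(Matrix.of A *ᵥ c) ⬝ᵥ (Matrix.of A *ᵥ c) - c ⬝ᵥ c|}
  have h1 := sensing_norm_tail hd hL hLd (x + y)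
  have h2 := sensing_norm_tail hd hL hLd (x - y)
  refine (measureReal_mono (s₂ := J (x + y) ∪ J (x - y)) fun A hA => ?_).trans
    ((measureReal_union_le _ _).trans (by linarith))
  by_contra hcon
  simp only [J, Set.mem_union, Set.mem_ofPred_eq, not_or, not_lt] at hcon
  obtain ⟨ha, hb⟩ := hcon
  have hA' : 40 * √(L / d) < |(Matrix.of A *ᵥ x) ⬝ᵥ (Matrix.of A *ᵥ y) - x ⬝ᵥ y| := hA
  rw [Matrix.mulVec_add] at ha
  rw [Matrix.mulVec_sub] at hb
  simp only [dotProduct_add, add_dotProduct, dotProduct_sub, sub_dotProduct] at ha hb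
  rw [dotProduct_comm (Matrix.of A *ᵥ y) (Matrix.of A *ᵥ x), dotProduct_comm y x] at ha hb
  obtain ⟨ha1, ha2⟩ := abs_le.mp ha
  obtain ⟨hb1, hb2⟩ := abs_le.mp hb
  have he : 0 ≤ 40 * √(L / d) := by positivity
  refine absurd hA' (not_lt.mpr (abs_le.mpr ⟨?_, ?_⟩)) <;> nlinarith

lemma sensing_inner_tail (hd : 0 < d) (hL : 0 ≤ L) (hLd : L ≤ d) {x y : Fin p → ℝ}
    (hx : x ⬝ᵥ x ≤ 1) {m : ℝ} (hm : 0 < m) (hy : y ⬝ᵥ y ≤ m ^ 2) :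
    (sensingLaw d p).real {A | 40 * √(L / d) * m <
        |(Matrix.of A *ᵥ x) ⬝ᵥ (Matrix.of A *ᵥ y) - x ⬝ᵥ y|} ≤ 4 * Real.exp (-(4 * L)) := by
  have hy' : (m⁻¹ • y) ⬝ᵥ (m⁻¹ • y) ≤ 1 := by
    rw [smul_dotProduct, dotProduct_smul, smul_smul, smul_eq_mul, ← mul_inv, ← sq,
      inv_mul_le_iff₀ (by positivity), mul_one]
    exact hy
  refine (measureReal_mono fun A hA => ?_).trans (sensing_inner_tail_unit hd hL hLd hx hy')
  have hA' : 40 * √(L / d) * m < |(Matrix.of A *ᵥ x) ⬝ᵥ (Matrix.of A *ᵥ y) - x ⬝ᵥ y| := hA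
  change 40 * √(L / d) < |(Matrix.of A *ᵥ x) ⬝ᵥ (Matrix.of A *ᵥ (m⁻¹ • y)) - x ⬝ᵥ (m⁻¹ • y)|
  rw [Matrix.mulVec_smul, dotProduct_smul, dotProduct_smul, ← smul_sub, smul_eq_mul, abs_mul,
    abs_of_pos (inv_pos.mpr hm), lt_inv_mul_iff₀ hm, mul_comm]
  exact hA'

/-- The vector `x` with the coordinates in `T` replaced by zero. -/
def eraseOn (T : Finset (Fin p)) (x : Fin p → ℝ) : Fin p → ℝ := fun k => if k ∈ T then 0 else x k

lemma measurable_eraseOn (T : Finset (Fin p)) : Measurable (eraseOn T) := by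
  refine measurable_pi_iff.mpr fun k => ?_
  unfold eraseOn
  split_ifs <;> fun_prop

/-- If `c` is supported on `T`, then `A c` is independent of the columns of `A` outside `T`, so
joint events of `A c` and the entries of `Aᵀ A c` outside `T` can be bounded conditionally. -/
lemma sensing_conditional_bound (T : Finset (Fin p)) {c : Fin p → ℝ} (hc : ∀ k, k ∉ T → c k = 0)
    {s : Set ((Fin d → ℝ) × (Fin p → ℝ))} (hs : MeasurableSet s) {δ : ℝ}
    (h : ∀ b : Fin d → ℝ, (Measure.pi fun _ : Fin p =>
      gaussianReal 0 ((b ⬝ᵥ b).toNNReal * (d : ℝ≥0)⁻¹)).real {w | (b, eraseOn T w) ∈ s} ≤ δ) :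
    (sensingLaw d p).real {A | (Matrix.of A *ᵥ c,
      eraseOn T ((Matrix.of A *ᵥ c) ᵥ* Matrix.of A)) ∈ s} ≤ δ := by
  have hR := measurePreserving_resample (ι := Fin d) (gaussianReal 0 ((d : ℝ≥0)⁻¹)) T
  have hAc : Measurable fun A : Fin d → Fin p → ℝ => Matrix.of A *ᵥ c :=
    measurable_mulVec measurable_id measurable_const
  have hset : MeasurableSet {A : Fin d → Fin p → ℝ | (Matrix.of A *ᵥ c,
      eraseOn T ((Matrix.of A *ᵥ c) ᵥ* Matrix.of A)) ∈ s} :=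
    (hAc.prodMk ((measurable_eraseOn T).comp (measurable_vecMul measurable_id hAc))) hs
  -- The columns outside `T` are replaced by those of an independent copy `B`. With `A` frozen, `A
  -- c` is a constant vector and the surviving coordinates depend on `B` alone.
  rw [real_eq_of_measurePreserving hR hset]
  refine prod_real_le_of_forall (hR.measurable hset) fun A => ?_
  refine le_trans (le_of_eq ?_) (h (Matrix.of A *ᵥ c))
  rw [real_eq_of_measurePreserving
    (measurePreserving_vecMul_gaussian (κ := Fin p) ((d : ℝ≥0)⁻¹) (Matrix.of A *ᵥ c))
    (show MeasurableSet {w | (Matrix.of A *ᵥ c, eraseOn T w) ∈ s} from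
      (measurable_const.prodMk (measurable_eraseOn T)) hs)]
  congr 1
  ext B
  simp only [Set.mem_preimage, Set.mem_ofPred_eq]
  have h1 : Matrix.of (fun i k => if k ∈ T then A i k else B i k) *ᵥ c = Matrix.of A *ᵥ c := by
    ext i
    simp only [Matrix.mulVec, dotProduct, Matrix.of_apply]
    refine Finset.sum_congr rfl fun k _ => ?_
    by_cases hk : k ∈ T
    · simp [hk]
    · simp [hc k hk]
  have h2 : ∀ b : Fin d → ℝ, eraseOn T (b ᵥ* Matrix.of (fun i k => if k ∈ T then A i k else B i k))
      = eraseOn T (b ᵥ* Matrix.of B) := by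
    intro b
    ext k
    by_cases hk : k ∈ T
    · simp [eraseOn, hk]
    · simp [eraseOn, hk, Matrix.vecMul, dotProduct]
  rw [h1, h2]

lemma sum_eraseOn_sq (T : Finset (Fin p)) (v : ℝ) (w : Fin p → ℝ) :
    ∑ k, (if k ∈ T then (0 : ℝ) else 1) * (w k ^ 2 - v)
      = eraseOn T w ⬝ᵥ eraseOn T w - (∑ k, if k ∈ T then (0 : ℝ) else 1) * v := by
  rw [Finset.sum_mul, dotProduct, ← Finset.sum_sub_distrib]
  refine Finset.sum_congr rfl fun k _ => ?_
  unfold eraseOn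
  split_ifs <;> ring

/-- Given `A c`, this is the diagonal tail bound with weights `0` on `T` and `1` elsewhere. The sum
of the weights is the number of surviving coordinates. -/
lemma sensing_gram_norm_tail (hp : 0 < p) (hL : 0 ≤ L) (hLp : L ≤ p)
    (T : Finset (Fin p)) {c : Fin p → ℝ} (hc : ∀ k, k ∉ T → c k = 0) :
    (sensingLaw d p).real {A |
      (Matrix.of A *ᵥ c) ⬝ᵥ (Matrix.of A *ᵥ c) * (d : ℝ)⁻¹ * (40 * √(p * L)) <
        |eraseOn T ((Matrix.of A *ᵥ c) ᵥ* Matrix.of A)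
            ⬝ᵥ eraseOn T ((Matrix.of A *ᵥ c) ᵥ* Matrix.of A)
          - (∑ k, if k ∈ T then (0 : ℝ) else 1)
            * ((Matrix.of A *ᵥ c) ⬝ᵥ (Matrix.of A *ᵥ c) * (d : ℝ)⁻¹)|}
      ≤ 2 * Real.exp (-(4 * L)) := by
  have hp' : (0 : ℝ) < p := Nat.cast_pos.mpr hp
  refine sensing_conditional_bound T hc (s := {q : (Fin d → ℝ) × (Fin p → ℝ) |
    q.1 ⬝ᵥ q.1 * (d : ℝ)⁻¹ * (40 * √(p * L)) < |q.2 ⬝ᵥ q.2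
      - (∑ k, if k ∈ T then (0 : ℝ) else 1) * (q.1 ⬝ᵥ q.1 * (d : ℝ)⁻¹)|}) ?_ fun b => ?_
  · have h1 := measurable_dotProduct (α := (Fin d → ℝ) × (Fin p → ℝ)) measurable_fst measurable_fst
    have h2 := measurable_dotProduct (α := (Fin d → ℝ) × (Fin p → ℝ)) measurable_snd measurable_snd
    exact measurableSet_lt (by fun_prop) (by fun_prop)
  · have h := gaussian_diag_tail_log (ι := Fin p) ((b ⬝ᵥ b).toNNReal * (d : ℝ≥0)⁻¹)
      (l := fun k => if k ∈ T then 0 else 1) (fun k => by split_ifs <;> simp) hp' (by simp) hL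
      zero_le_one (by simpa using hLp)
    simp only [sum_eraseOn_sq, NNReal.coe_mul, Real.coe_toNNReal _ (dotProduct_self_nonneg' b),
      NNReal.coe_inv, NNReal.coe_natCast] at h
    convert h using 6
    norm_num

lemma quadForm_eraseOn (T : Finset (Fin p)) (M : Matrix (Fin p) (Fin p) ℝ) (w : Fin p → ℝ) :
    eraseOn T w ⬝ᵥ M *ᵥ eraseOn T w
      = w ⬝ᵥ (Matrix.of fun i j => if i ∈ T ∨ j ∈ T then 0 else M i j) *ᵥ w := by
  simp only [dotProduct, Matrix.mulVec, Finset.mul_sum, Matrix.of_apply, eraseOn]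
  refine Finset.sum_congr rfl fun i _ => Finset.sum_congr rfl fun j _ => ?_
  by_cases hi : i ∈ T <;> by_cases hj : j ∈ T <;> simp [hi, hj]

/-- Erasing coordinates amounts to deleting rows and columns of `offDiag S`, which keeps the trace
zero and does not increase the Frobenius norm. -/
lemma sensing_gram_quadForm_tail (hL : 1 ≤ L) (T : Finset (Fin p)) {c : Fin p → ℝ}
    (hc : ∀ k, k ∉ T → c k = 0) {S : Matrix (Fin p) (Fin p) ℝ} (hS : S.IsHermitian) :
    (sensingLaw d p).real {A |
      (Matrix.of A *ᵥ c) ⬝ᵥ (Matrix.of A *ᵥ c) * (d : ℝ)⁻¹ * (20 * L * offFrobNorm S) <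
        |eraseOn T ((Matrix.of A *ᵥ c) ᵥ* Matrix.of A)
            ⬝ᵥ offDiag S *ᵥ eraseOn T ((Matrix.of A *ᵥ c) ᵥ* Matrix.of A)|}
      ≤ 2 * Real.exp (-(4 * L)) := by
  refine sensing_conditional_bound T hc (s := {q : (Fin d → ℝ) × (Fin p → ℝ) |
    q.1 ⬝ᵥ q.1 * (d : ℝ)⁻¹ * (20 * L * offFrobNorm S) < |q.2 ⬝ᵥ offDiag S *ᵥ q.2|}) ?_ fun b => ?_
  · have h1 := measurable_dotProduct (α := (Fin d → ℝ) × (Fin p → ℝ)) measurable_fst measurable_fst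
    have h2 := measurable_dotProduct (α := (Fin d → ℝ) × (Fin p → ℝ)) measurable_snd
      (measurable_mulVec (f := fun _ => offDiag S) measurable_const measurable_snd)
    exact measurableSet_lt (by fun_prop) (h2.abs)
  · set M : Matrix (Fin p) (Fin p) ℝ :=
      Matrix.of fun i j => if i ∈ T ∨ j ∈ T then 0 else offDiag S i j with hMdef
    have hM : M.IsHermitian := by
      ext i j
      have := hS.apply i j
      simp only [star_trivial] at this
      simp only [hMdef, Matrix.conjTranspose_apply, Matrix.of_apply, star_trivial, offDiag, this,
        eq_comm (a := j), or_comm (a := j ∈ T)]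
    have htr : M.trace = 0 := by
      simp [hMdef, Matrix.trace, offDiag]
    have hF : √(∑ i, ∑ j, M i j ^ 2) ≤ offFrobNorm S := by
      unfold offFrobNorm
      refine Real.sqrt_le_sqrt (Finset.sum_le_sum fun i _ => Finset.sum_le_sum fun j _ => ?_)
      simp only [hMdef, Matrix.of_apply, offDiag]
      split_ifs <;> simp [sq_nonneg]
    have h := gaussian_quadForm_tail_log ((b ⬝ᵥ b).toNNReal * (d : ℝ≥0)⁻¹) hM htr hF hL
    simp only [NNReal.coe_mul, Real.coe_toNNReal _ (dotProduct_self_nonneg' b),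
      NNReal.coe_inv, NNReal.coe_natCast] at h
    simpa only [Set.mem_ofPred_eq, quadForm_eraseOn] using h

/-! ### The empirical second moments of the observations -/

/-- For fixed `A`, the empirical variance of `n` i.i.d. centred Gaussians of variance `G`. The error
is relative to `G`, which will later depend on `A`. -/
lemma obs_second_moment_tail {n d p : ℕ} {S : Matrix (Fin p) (Fin p) ℝ} (hS : S.PosSemidef)
    (σ : ℝ≥0) {L K : ℝ} (hn : 0 < n) (hL : 0 ≤ L) (hK : 0 ≤ K) (hLn : L ≤ K * n)
    (A : Fin d → Fin p → ℝ) (b : Fin d → ℝ) {G : ℝ}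
    (hG : G = (b ᵥ* Matrix.of A) ⬝ᵥ S *ᵥ (b ᵥ* Matrix.of A) + b ⬝ᵥ b * (σ : ℝ) ^ 2) :
    ((Measure.pi fun _ : Fin n => multivariateGaussian 0 S).prod
        (Measure.pi fun _ : Fin n => Measure.pi fun _ : Fin d => gaussianReal 0 (σ ^ 2))).real
      {q | 20 * (1 + K) * √(L / n) * G
        < |(n : ℝ)⁻¹ * ∑ s, (b ⬝ᵥ obs A q.1 q.2 s) ^ 2 - G|}
      ≤ 2 * Real.exp (-(4 * L)) := by
  have hn' : (0 : ℝ) < n := Nat.cast_pos.mpr hn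
  have hmp := measurePreserving_dotProduct_obs (n := n) hS σ A b
  set v : ℝ≥0 := ((b ᵥ* Matrix.of A) ⬝ᵥ S *ᵥ (b ᵥ* Matrix.of A)).toNNReal
          + (b ⬝ᵥ b).toNNReal * σ ^ 2 with hv
  have hvG : (v : ℝ) = G := by
    rw [hG, hv, NNReal.coe_add, NNReal.coe_mul, Real.coe_toNNReal _ (dotProduct_self_nonneg' b),
      Real.coe_toNNReal, NNReal.coe_pow]
    simpa using hS.dotProduct_mulVec_nonneg (b ᵥ* Matrix.of A)
  have h := gaussian_diag_tail_log (ι := Fin n) v (l := fun _ => 1) (by simp) hn' (by simp) hL hK hLn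
  rw [real_eq_of_measurePreserving hmp (measurableSet_lt (by fun_prop) (by fun_prop))] at h
  refine (measureReal_mono fun q hq => ?_).trans h
  have hq' : 20 * (1 + K) * √(L / n) * G
        < |(n : ℝ)⁻¹ * ∑ s, (b ⬝ᵥ obs A q.1 q.2 s) ^ 2 - G| := hq
  change v * (20 * (1 + K) * √(n * L)) < |∑ s, (1 : ℝ) * ((b ⬝ᵥ obs A q.1 q.2 s) ^ 2 - v)|
  rw [hvG]
  have hsq : √(n * L) = n * √(L / n) := by
    rw [show (n : ℝ) * L = n ^ 2 * (L / n) by field_simp, Real.sqrt_mul (by positivity),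
      Real.sqrt_sq hn'.le]
  have hsum : ∑ s, (1 : ℝ) * ((b ⬝ᵥ obs A q.1 q.2 s) ^ 2 - G)
      = n * ((n : ℝ)⁻¹ * ∑ s, (b ⬝ᵥ obs A q.1 q.2 s) ^ 2 - G) := by
    simp only [one_mul, Finset.sum_sub_distrib, Finset.sum_const, Finset.card_univ,
      Fintype.card_fin, nsmul_eq_mul]
    field_simp
  rw [hsum, abs_mul, abs_of_pos hn', hsq]
  calc G * (20 * (1 + K) * (n * √(L / n))) = n * (20 * (1 + K) * √(L / n) * G) := by ring
    _ < _ := mul_lt_mul_of_pos_left hq' hn'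

end

section

/-! ### Correlation matrices -/

variable {p : ℕ}

lemma apply_symm_of_isHermitian {S : Matrix (Fin p) (Fin p) ℝ} (hS : S.IsHermitian) (i j : Fin p) :
    S i j = S j i := by
  simpa using (hS.apply i j).symm

lemma dotProduct_mulVec_symm {S : Matrix (Fin p) (Fin p) ℝ} (hS : S.IsHermitian)
    (x y : Fin p → ℝ) : x ⬝ᵥ S *ᵥ y = y ⬝ᵥ S *ᵥ x := by
  have hT : Sᵀ = S := by ext i j; exact apply_symm_of_isHermitian hS j i
  rw [Matrix.dotProduct_mulVec, dotProduct_comm, ← Matrix.mulVec_transpose, hT]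

/-- Positivity of the form at `eᵢ ± eⱼ` gives `2 ± 2 Sᵢⱼ ≥ 0`. -/
lemma abs_apply_le_one {S : Matrix (Fin p) (Fin p) ℝ} (hS : S.PosSemidef) (h1 : ∀ i, S i i = 1)
    (i j : Fin p) : |S i j| ≤ 1 := by
  have hp := hS.dotProduct_mulVec_nonneg (Pi.single i 1 + Pi.single j 1)
  have hm := hS.dotProduct_mulVec_nonneg (Pi.single i 1 - Pi.single j 1)
  simp only [star_trivial, Matrix.mulVec_add, Matrix.mulVec_sub, Matrix.mulVec_single_one,
    add_dotProduct, sub_dotProduct, single_dotProduct, one_mul, Pi.add_apply, Pi.sub_apply,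
    Matrix.col_apply, h1, apply_symm_of_isHermitian hS.1 j i] at hp hm
  exact abs_le.mpr ⟨by linarith, by linarith⟩

lemma column_sq_le_maxColNorm_sq (S : Matrix (Fin p) (Fin p) ℝ) (j : Fin p) :
    ∑ i, S i j ^ 2 ≤ maxColNorm S ^ 2 := by
  have h : √(∑ i, S i j ^ 2) ≤ maxColNorm S :=
    le_ciSup (f := fun j => √(∑ i, S i j ^ 2)) (Set.finite_range _).bddAbove j
  exact (Real.sqrt_le_left ((Real.sqrt_nonneg _).trans h)).mp h

lemma maxColNorm_nonneg (S : Matrix (Fin p) (Fin p) ℝ) : 0 ≤ maxColNorm S :=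
  Real.iSup_nonneg fun _ => Real.sqrt_nonneg _

lemma one_le_maxColNorm {S : Matrix (Fin p) (Fin p) ℝ} (h1 : ∀ i, S i i = 1) (j : Fin p) :
    1 ≤ maxColNorm S := by
  have h := column_sq_le_maxColNorm_sq S j
  have h' : S j j ^ 2 ≤ ∑ i, S i j ^ 2 :=
    Finset.single_le_sum (f := fun i => S i j ^ 2) (fun _ _ => sq_nonneg _) (Finset.mem_univ j)
  rw [h1] at h'
  nlinarith [maxColNorm_nonneg S]

lemma offFrobNorm_le {S : Matrix (Fin p) (Fin p) ℝ} (hS : ∀ i j, |S i j| ≤ 1) :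
    offFrobNorm S ≤ p := by
  unfold offFrobNorm
  refine Real.sqrt_le_iff.mpr ⟨by positivity, ?_⟩
  calc ∑ i, ∑ j, (if i = j then 0 else S i j ^ 2) ≤ ∑ _i : Fin p, ∑ _j : Fin p, (1 : ℝ) := by
        refine Finset.sum_le_sum fun i _ => Finset.sum_le_sum fun j _ => ?_
        split_ifs
        · exact zero_le_one
        · exact (sq_le_one_iff_abs_le_one _).mpr (hS i j)
    _ = (p : ℝ) ^ 2 := by simp [sq]

lemma quadForm_eq_offDiag_add {S : Matrix (Fin p) (Fin p) ℝ} (h1 : ∀ i, S i i = 1)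
    (z : Fin p → ℝ) : z ⬝ᵥ S *ᵥ z = z ⬝ᵥ offDiag S *ᵥ z + z ⬝ᵥ z := by
  have : S = offDiag S + 1 := by
    ext i j
    by_cases h : i = j
    · subst h; simp [offDiag, h1]
    · simp [offDiag, h]
  conv_lhs => rw [this]
  rw [Matrix.add_mulVec, dotProduct_add, Matrix.one_mulVec]

/-! ### Removing two coordinates -/

lemma eraseOn_pair_eq {i j : Fin p} (hij : i ≠ j) (x : Fin p → ℝ) :
    eraseOn {i, j} x = x - Pi.single i (x i) - Pi.single j (x j) := by
  ext k
  by_cases hi : k = i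
  · subst hi; simp [eraseOn, hij]
  · by_cases hj : k = j
    · subst hj; simp [eraseOn, hi]
    · simp [eraseOn, hi, hj]

lemma eraseOn_pair_dotProduct {i j : Fin p} (hij : i ≠ j) (x w : Fin p → ℝ) :
    eraseOn {i, j} x ⬝ᵥ w = x ⬝ᵥ w - x i * w i - x j * w j := by
  rw [eraseOn_pair_eq hij, sub_dotProduct, sub_dotProduct, single_dotProduct, single_dotProduct]

/-- In a bilinear form the coordinates `i`, `j` can be removed from both arguments, at a cost
controlled by the size of these coordinates. -/
lemma abs_bilin_sub_eraseOn_le {S : Matrix (Fin p) (Fin p) ℝ} (hS : S.IsHermitian)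
    (hS1 : ∀ i j, |S i j| ≤ 1) {ε m : ℝ} (hm : 1 ≤ m) {i j : Fin p} (hij : i ≠ j)
    {e f : Fin p → ℝ} (he : ∀ k, |e k| ≤ ε) (hf : ∀ k, |f k| ≤ ε)
    (hSe : ∀ k, |(S *ᵥ e) k| ≤ ε * m) (hSf : ∀ k, |(S *ᵥ f) k| ≤ ε * m) :
    |e ⬝ᵥ S *ᵥ f - eraseOn {i, j} e ⬝ᵥ S *ᵥ eraseOn {i, j} f| ≤ 8 * ε ^ 2 * m := by
  have hSv : ∀ k, (S *ᵥ eraseOn {i, j} f) k = (S *ᵥ f) k - S k i * f i - S k j * f j := by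
    intro k
    have := eraseOn_pair_dotProduct hij f (S k)
    rw [Matrix.mulVec, dotProduct_comm, this, dotProduct_comm, Matrix.mulVec]
    ring
  have hev : e ⬝ᵥ S *ᵥ eraseOn {i, j} f
      = e ⬝ᵥ S *ᵥ f - f i * (S *ᵥ e) i - f j * (S *ᵥ e) j := by
    rw [dotProduct_mulVec_symm hS, eraseOn_pair_dotProduct hij, dotProduct_mulVec_symm hS]
  rw [eraseOn_pair_dotProduct hij, hev, hSv, hSv]
  have b1 : ∀ {x y u v : ℝ}, |x| ≤ u → |y| ≤ v → |x * y| ≤ u * v := by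
    intro x y u v hx hy
    rw [abs_mul]
    exact mul_le_mul hx hy (abs_nonneg _) ((abs_nonneg _).trans hx)
  have b2 : ∀ k l r, |e k * (S r l * f l)| ≤ ε * (1 * ε) := fun k l r => b1 (he k) (b1 (hS1 r l) (hf l))
  -- The difference splits into four products of size `ε²m` and four corrections of size `ε² ≤ ε²m`,
  -- whence the `8`.
  have t1 := abs_le.mp (b1 (hf i) (hSe i))
  have t2 := abs_le.mp (b1 (hf j) (hSe j))
  have t3 := abs_le.mp (b1 (he i) (hSf i))
  have t4 := abs_le.mp (b1 (he j) (hSf j))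
  have t5 := abs_le.mp (b2 i i i)
  have t6 := abs_le.mp (b2 i j i)
  have t7 := abs_le.mp (b2 j i j)
  have t8 := abs_le.mp (b2 j j j)
  have hmm : ε ^ 2 ≤ ε ^ 2 * m := le_mul_of_one_le_right (sq_nonneg _) hm
  refine abs_le.mpr ⟨?_, ?_⟩ <;> nlinarith

/-! ### Polarization along `eᵢ ± eⱼ` -/

/-- The vector `eᵢ + τ eⱼ`. -/
def pairVec (i j : Fin p) (τ : ℝ) : Fin p → ℝ := Pi.single i 1 + τ • Pi.single j 1

lemma pairVec_eq_zero {i j k : Fin p} (τ : ℝ) (hk : k ∉ ({i, j} : Finset (Fin p))) :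
    pairVec i j τ k = 0 := by
  simp only [Finset.mem_insert, Finset.mem_singleton, not_or] at hk
  simp [pairVec, hk.1, hk.2]

lemma mulVec_pairVec {ι : Type*} (B : Matrix ι (Fin p) ℝ) (i j : Fin p) (τ : ℝ) :
    B *ᵥ pairVec i j τ = B.col i + τ • B.col j := by
  rw [pairVec, Matrix.mulVec_add, Matrix.mulVec_smul, Matrix.mulVec_single_one,
    Matrix.mulVec_single_one]

lemma eraseOn_add_smul (T : Finset (Fin p)) (x y : Fin p → ℝ) (τ : ℝ) :
    eraseOn T (x + τ • y) = eraseOn T x + τ • eraseOn T y := by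
  ext k
  by_cases hk : k ∈ T <;> simp [eraseOn, hk]

lemma quadForm_add_smul {S : Matrix (Fin p) (Fin p) ℝ} (hS : S.IsHermitian) (x y : Fin p → ℝ)
    (τ : ℝ) : (x + τ • y) ⬝ᵥ S *ᵥ (x + τ • y)
      = x ⬝ᵥ S *ᵥ x + 2 * τ * (x ⬝ᵥ S *ᵥ y) + τ ^ 2 * (y ⬝ᵥ S *ᵥ y) := by
  simp only [Matrix.mulVec_add, Matrix.mulVec_smul, dotProduct_add, add_dotProduct,
    dotProduct_smul, smul_dotProduct, smul_eq_mul]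
  rw [dotProduct_mulVec_symm hS y x]
  ring

/-- Split `y = x + z` with `x` supported on `{i,j}`. Positivity of the form at `x - z` yields `yᵀSy
≤ 2xᵀSx + 2zᵀSz`, and `xᵀSx ≤ 4a²`. -/
lemma quadForm_le_eraseOn {S : Matrix (Fin p) (Fin p) ℝ} (hS : S.PosSemidef)
    (h1 : ∀ i, S i i = 1) {i j : Fin p} (hij : i ≠ j) {y : Fin p → ℝ} {a : ℝ}
    (hi : |y i| ≤ a) (hj : |y j| ≤ a) :
    y ⬝ᵥ S *ᵥ y ≤ 8 * a ^ 2 + 2 * (eraseOn {i, j} y ⬝ᵥ S *ᵥ eraseOn {i, j} y) := by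
  set z := eraseOn {i, j} y with hz
  set x : Fin p → ℝ := Pi.single i (y i) + Pi.single j (y j) with hx
  have hy : y = x + (1 : ℝ) • z := by rw [hz, eraseOn_pair_eq hij, hx, one_smul]; abel
  have hsub := hS.dotProduct_mulVec_nonneg (x + (-1 : ℝ) • z)
  rw [star_trivial, quadForm_add_smul hS.1] at hsub
  have hxx : x ⬝ᵥ S *ᵥ x = y i ^ 2 + 2 * (y i * y j * S i j) + y j ^ 2 := by
    have e1 : x ⬝ᵥ S *ᵥ x = y i * (S *ᵥ x) i + y j * (S *ᵥ x) j := by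
      conv_lhs => rw [hx]
      rw [add_dotProduct, single_dotProduct, single_dotProduct]
    have e2 : ∀ k, (S *ᵥ x) k = S k i * y i + S k j * y j := by
      intro k
      simp [hx, Matrix.mulVec, dotProduct_add, dotProduct_single]
    rw [e1, e2, e2, h1, h1, apply_symm_of_isHermitian hS.1 j i]
    ring
  have ha : 0 ≤ a := (abs_nonneg _).trans hi
  have hyi : y i ^ 2 ≤ a ^ 2 := sq_le_sq' (abs_le.mp hi).1 (abs_le.mp hi).2
  have hyj : y j ^ 2 ≤ a ^ 2 := sq_le_sq' (abs_le.mp hj).1 (abs_le.mp hj).2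
  have hmix : y i * y j * S i j ≤ a ^ 2 := by
    refine (le_abs_self _).trans ?_
    rw [abs_mul, abs_mul]
    calc |y i| * |y j| * |S i j| ≤ a * a * 1 := by
          gcongr
          exact abs_apply_le_one hS h1 i j
      _ = a ^ 2 := by ring
  rw [hy, quadForm_add_smul hS.1]
  linarith

/-! ### Deterministic error bounds on the good event -/

/-- The variance of a linear functional of an observation along `A (eᵢ + τ eⱼ)`, in terms of the
Gram matrix `g = Aᵀ A`. -/
def pairVar (g S : Matrix (Fin p) (Fin p) ℝ) (σ : ℝ) (i j : Fin p) (τ : ℝ) : ℝ :=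
  (g *ᵥ pairVec i j τ) ⬝ᵥ S *ᵥ (g *ᵥ pairVec i j τ)
    + pairVec i j τ ⬝ᵥ g *ᵥ pairVec i j τ * σ ^ 2

lemma pairVec_quadForm {g : Matrix (Fin p) (Fin p) ℝ} (hg : g.IsHermitian) (i j : Fin p) (τ : ℝ) :
    pairVec i j τ ⬝ᵥ g *ᵥ pairVec i j τ = g i i + 2 * τ * g i j + τ ^ 2 * g j j := by
  rw [pairVec, quadForm_add_smul hg]
  simp [single_dotProduct]

/-- A crude bound suffices, since it only enters the variance: `offFrobNorm S`, `√(p * L)` and `q`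
are all at most `p`, giving `20 + 40 + 1 = 61`. -/
lemma quadForm_eraseOn_le {S : Matrix (Fin p) (Fin p) ℝ} (h1 : ∀ i, S i i = 1)
    (hS1 : ∀ i j, |S i j| ≤ 1) {L β q : ℝ} (hL : 1 ≤ L) (hLp : L ≤ p) (hβ : 0 ≤ β) (hq : q ≤ p)
    {z : Fin p → ℝ} (hQ : |z ⬝ᵥ offDiag S *ᵥ z| ≤ β * (20 * L * offFrobNorm S))
    (hN : |z ⬝ᵥ z - q * β| ≤ β * (40 * √(p * L))) :
    z ⬝ᵥ S *ᵥ z ≤ 61 * β * (L * p) := by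
  rw [quadForm_eq_offDiag_add h1]
  have hF := offFrobNorm_le hS1
  have hp : (0 : ℝ) ≤ p := by positivity
  have hsq : √(p * L) ≤ p := Real.sqrt_le_iff.mpr ⟨hp, by nlinarith⟩
  have hpL : (p : ℝ) ≤ L * p := le_mul_of_one_le_left hp hL
  have e1 : β * (20 * L * offFrobNorm S) ≤ β * (20 * L * p) := by gcongr
  have e2 : β * (40 * √(p * L)) ≤ β * (40 * (L * p)) := by gcongr; linarith
  have e3 : q * β ≤ (L * p) * β := by gcongr; linarith
  have := (abs_le.mp hQ).2
  have := (abs_le.mp hN).2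
  linarith

lemma pairVar_le {g S : Matrix (Fin p) (Fin p) ℝ} (hg : g.IsHermitian) (hS : S.PosSemidef)
    (h1 : ∀ i, S i i = 1) {L ε D q : ℝ} (hL : 1 ≤ L) (hLp : L ≤ p) (hD : 0 < D)
    (hε : ε ≤ 40) (hq : q ≤ p)
    (hE : ∀ a b, |g a b - (1 : Matrix (Fin p) (Fin p) ℝ) a b| ≤ ε) {i j : Fin p} (hij : i ≠ j)
    (σ : ℝ) {τ : ℝ} (hτ : |τ| = 1)
    (hβ0 : 0 ≤ pairVec i j τ ⬝ᵥ g *ᵥ pairVec i j τ)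
    (hQ : |eraseOn {i, j} (g *ᵥ pairVec i j τ) ⬝ᵥ offDiag S *ᵥ eraseOn {i, j} (g *ᵥ pairVec i j τ)|
      ≤ pairVec i j τ ⬝ᵥ g *ᵥ pairVec i j τ * D⁻¹ * (20 * L * offFrobNorm S))
    (hN : |eraseOn {i, j} (g *ᵥ pairVec i j τ) ⬝ᵥ eraseOn {i, j} (g *ᵥ pairVec i j τ)
        - q * (pairVec i j τ ⬝ᵥ g *ᵥ pairVec i j τ * D⁻¹)|
      ≤ pairVec i j τ ⬝ᵥ g *ᵥ pairVec i j τ * D⁻¹ * (40 * √(p * L))) :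
    pairVar g S σ i j τ ≤ 60000 * (1 + p * L / D + σ ^ 2) := by
  have hgij := abs_le.mp (hE i j)
  have hgji := abs_le.mp (hE j i)
  have hgii := abs_le.mp (hE i i)
  have hgjj := abs_le.mp (hE j j)
  simp only [Matrix.one_apply_eq, Matrix.one_apply_ne hij, Matrix.one_apply_ne hij.symm] at *
  -- `ε ≤ 40` gives `g i i ≤ 41` and `|g i j| ≤ 40`, hence `2·41 + 2·40 = 162` here and `41 + 40 =
  -- 81` below.
  have hbb : pairVec i j τ ⬝ᵥ g *ᵥ pairVec i j τ ≤ 162 := by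
    rw [pairVec_quadForm hg]
    rcases (abs_eq zero_le_one).mp hτ with h | h <;> subst h <;> linarith
  have hyi : |(g *ᵥ pairVec i j τ) i| ≤ 81 := by
    rw [mulVec_pairVec]
    simp only [Pi.add_apply, Pi.smul_apply, smul_eq_mul, Matrix.col_apply]
    rcases (abs_eq zero_le_one).mp hτ with h | h <;> subst h <;>
      exact abs_le.mpr ⟨by linarith, by linarith⟩
  have hyj : |(g *ᵥ pairVec i j τ) j| ≤ 81 := by
    rw [mulVec_pairVec]
    simp only [Pi.add_apply, Pi.smul_apply, smul_eq_mul, Matrix.col_apply]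
    rcases (abs_eq zero_le_one).mp hτ with h | h <;> subst h <;>
      exact abs_le.mpr ⟨by linarith, by linarith⟩
  have hq1 := quadForm_le_eraseOn hS h1 hij hyi hyj
  have hq2 := quadForm_eraseOn_le h1 (abs_apply_le_one hS h1) hL hLp (by positivity) hq hQ hN
  have hLp0 : 0 ≤ L * p := by positivity
  have e1 : 61 * (pairVec i j τ ⬝ᵥ g *ᵥ pairVec i j τ * D⁻¹) * (L * p)
      ≤ 61 * (162 * D⁻¹) * (L * p) := by gcongr
  have e2 : pairVec i j τ ⬝ᵥ g *ᵥ pairVec i j τ * σ ^ 2 ≤ 162 * σ ^ 2 := by gcongr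
  have e3 : 61 * (162 * D⁻¹) * (L * p) = 9882 * (p * L / D) := by
    rw [div_eq_mul_inv]; ring
  have e4 : 0 ≤ p * L / D := by positivity
  have e5 : 0 ≤ σ ^ 2 := sq_nonneg σ
  unfold pairVar
  linarith

/-- Here `(a + 2τc + τ²b)δ` is the conditional variance `β` for `τ = ±1`. Fluctuations of size `R`,
`N` add up, whereas the centres `qβ` nearly cancel, leaving `4qcδ`. -/
lemma abs_polarization_le {x Q₁ Q₂ N₁ N₂ a b c q R N δ B : ℝ}
    (hpol : 4 * x = Q₁ + N₁ - (Q₂ + N₂))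
    (hQ₁ : |Q₁| ≤ (a + 2 * 1 * c + 1 ^ 2 * b) * δ * R)
    (hQ₂ : |Q₂| ≤ (a + 2 * (-1) * c + (-1) ^ 2 * b) * δ * R)
    (hN₁ : |N₁ - q * ((a + 2 * 1 * c + 1 ^ 2 * b) * δ)| ≤ (a + 2 * 1 * c + 1 ^ 2 * b) * δ * N)
    (hN₂ : |N₂ - q * ((a + 2 * (-1) * c + (-1) ^ 2 * b) * δ)|
      ≤ (a + 2 * (-1) * c + (-1) ^ 2 * b) * δ * N)
    (hq : |q * (c * δ)| ≤ B) :
    |x| ≤ (a + b) * ((R + N) * δ) + B := by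
  obtain ⟨h1, h2⟩ := abs_le.mp hQ₁
  obtain ⟨h3, h4⟩ := abs_le.mp hQ₂
  obtain ⟨h5, h6⟩ := abs_le.mp hN₁
  obtain ⟨h7, h8⟩ := abs_le.mp hN₂
  obtain ⟨h9, h10⟩ := abs_le.mp hq
  refine abs_le.mpr ⟨?_, ?_⟩ <;> linarith

/-- The bias term. -/
lemma abs_gram_bilin_sub_le {g S : Matrix (Fin p) (Fin p) ℝ} (hg : g.IsHermitian)
    (hS : S.PosSemidef) (h1 : ∀ i, S i i = 1) {L ε m D q : ℝ} (hD : 0 < D)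
    (hε0 : 0 ≤ ε) (hε : ε ≤ 40) (hm : 1 ≤ m) (hL : 0 ≤ L) (hq0 : 0 ≤ q) (hq : q ≤ p)
    (hE : ∀ a b, |g a b - (1 : Matrix (Fin p) (Fin p) ℝ) a b| ≤ ε)
    (hES : ∀ a b, |(g * S) a b - S a b| ≤ ε * m) {i j : Fin p} (hij : i ≠ j)
    (hQ : ∀ τ : ℝ, |τ| = 1 →
      |eraseOn {i, j} (g *ᵥ pairVec i j τ) ⬝ᵥ offDiag S *ᵥ eraseOn {i, j} (g *ᵥ pairVec i j τ)|
      ≤ pairVec i j τ ⬝ᵥ g *ᵥ pairVec i j τ * D⁻¹ * (20 * L * offFrobNorm S))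
    (hN : ∀ τ : ℝ, |τ| = 1 →
      |eraseOn {i, j} (g *ᵥ pairVec i j τ) ⬝ᵥ eraseOn {i, j} (g *ᵥ pairVec i j τ)
        - q * (pairVec i j τ ⬝ᵥ g *ᵥ pairVec i j τ * D⁻¹)|
      ≤ pairVec i j τ ⬝ᵥ g *ᵥ pairVec i j τ * D⁻¹ * (40 * √(p * L))) :
    |g.col i ⬝ᵥ S *ᵥ g.col j - S i j|
      ≤ 322 * ε * m + 1640 * (L / D * offFrobNorm S) + 3280 * (√(p * L) / D) + p * ε / D := by
  set e : Fin p → ℝ := g.col i - Pi.single i 1 with he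
  set f : Fin p → ℝ := g.col j - Pi.single j 1 with hf
  have hcol : ∀ a k, (g.col a - Pi.single a 1 : Fin p → ℝ) k
      = g k a - (1 : Matrix (Fin p) (Fin p) ℝ) k a := by
    intro a k
    simp [Matrix.one_apply, Pi.single_apply]
  have hcol_le : ∀ a k, |(g.col a - Pi.single a 1 : Fin p → ℝ) k| ≤ ε := fun a k => by
    rw [hcol]; exact hE k a
  have hScol : ∀ a k, (S *ᵥ (g.col a - Pi.single a 1)) k = (g * S) a k - S a k := by
    intro a k
    rw [Matrix.mulVec_sub, Matrix.mulVec_single_one, Pi.sub_apply, Matrix.col_apply,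
      apply_symm_of_isHermitian hS.1 k a, Matrix.mul_apply]
    simp only [Matrix.mulVec, dotProduct, Matrix.col_apply]
    congr 1
    refine Finset.sum_congr rfl fun l _ => ?_
    rw [apply_symm_of_isHermitian hS.1 k l, apply_symm_of_isHermitian hg l a, mul_comm]
  have hScol_le : ∀ a k, |(S *ᵥ (g.col a - Pi.single a 1)) k| ≤ ε * m := fun a k => by
    rw [hScol]; exact hES a k
  have hcross := abs_bilin_sub_eraseOn_le hS.1 (abs_apply_le_one hS h1) hm hij
    (hcol_le i) (hcol_le j) (hScol_le i) (hScol_le j)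
  rw [← he, ← hf] at hcross
  -- Expansion around `eᵢ` and `eⱼ`: two linear terms and one quadratic term.
  have hexp : g.col i ⬝ᵥ S *ᵥ g.col j - S i j
      = (S *ᵥ f) i + (S *ᵥ e) j + e ⬝ᵥ S *ᵥ f := by
    have hgi : g.col i = e + Pi.single i 1 := by rw [he]; abel
    have hgj : g.col j = f + Pi.single j 1 := by rw [hf]; abel
    rw [hgi, hgj, Matrix.mulVec_add, add_dotProduct, dotProduct_add, dotProduct_add,
      single_dotProduct, single_dotProduct, dotProduct_mulVec_symm hS.1 e (Pi.single j 1),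
      single_dotProduct, Matrix.mulVec_single_one, Matrix.col_apply]
    ring
  set u := eraseOn {i, j} e
  set w := eraseOn {i, j} f
  -- Outside `{i,j}` the subtracted unit vectors vanish, so `u + τw` is the erased `g c`, to which
  -- the conditional bounds apply.
  have hz : ∀ τ : ℝ, eraseOn {i, j} (g *ᵥ pairVec i j τ) = u + τ • w := by
    intro τ
    rw [mulVec_pairVec, ← eraseOn_add_smul]
    ext k
    by_cases hk : k ∈ ({i, j} : Finset (Fin p))
    · simp only [eraseOn, hk, if_true]
    · have hk' := hk
      simp only [Finset.mem_insert, Finset.mem_singleton, not_or] at hk'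
      simp only [eraseOn, hk, if_false, he, hf, Pi.add_apply, Pi.smul_apply, Pi.sub_apply,
        Pi.single_eq_of_ne hk'.1, Pi.single_eq_of_ne hk'.2, sub_zero]
  have hpol : 4 * (u ⬝ᵥ S *ᵥ w) = (u + (1 : ℝ) • w) ⬝ᵥ S *ᵥ (u + (1 : ℝ) • w)
      - (u + (-1 : ℝ) • w) ⬝ᵥ S *ᵥ (u + (-1 : ℝ) • w) := by
    rw [quadForm_add_smul hS.1, quadForm_add_smul hS.1]; ring
  have hQ1 := hQ 1 (by simp)
  have hQ2 := hQ (-1) (by simp)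
  have hN1 := hN 1 (by simp)
  have hN2 := hN (-1) (by simp)
  rw [hz, pairVec_quadForm hg] at hQ1 hQ2 hN1 hN2
  rw [quadForm_eq_offDiag_add h1, quadForm_eq_offDiag_add h1 (u + (-1 : ℝ) • w)] at hpol
  have hgij := hE i j
  have hgii := abs_le.mp (hE i i)
  have hgjj := abs_le.mp (hE j j)
  simp only [Matrix.one_apply_eq, Matrix.one_apply_ne hij, sub_zero] at hgij hgii hgjj
  have hF0 : 0 ≤ offFrobNorm S := Real.sqrt_nonneg _
  set R := 20 * L * offFrobNorm S with hR
  set N := 40 * √(p * L) with hNdef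
  have hRN : 0 ≤ (R + N) * D⁻¹ := by positivity
  have hdiag : (g i i + g j j) * ((R + N) * D⁻¹) ≤ 82 * ((R + N) * D⁻¹) :=
    mul_le_mul_of_nonneg_right (by linarith) hRN
  have hqg : |q * (g i j * D⁻¹)| ≤ p * ε / D := by
    rw [abs_mul, abs_mul, abs_of_nonneg hq0, abs_of_pos (inv_pos.mpr hD), div_eq_mul_inv, mul_assoc]
    gcongr
  have hRNe : 82 * ((R + N) * D⁻¹) = 1640 * (L / D * offFrobNorm S) + 3280 * (√(p * L) / D) := by
    rw [hR, hNdef]; field_simp; ring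
  have huw : |u ⬝ᵥ S *ᵥ w| ≤ 1640 * (L / D * offFrobNorm S) + 3280 * (√(p * L) / D)
      + p * ε / D := by
    rw [← hRNe]
    exact (abs_polarization_le hpol hQ1 hQ2 hN1 hN2 hqg).trans (by linarith)
  -- `ε ≤ 40` makes the cost of erasing linear in `ε`; with the two linear terms this gives `322`.
  have hsq : 8 * ε ^ 2 * m ≤ 320 * ε * m := by nlinarith [mul_nonneg hε0 (by linarith : 0 ≤ m)]
  have s1 := abs_le.mp (hScol_le i j)
  have s2 := abs_le.mp (hScol_le j i)
  have s3 := abs_le.mp hcross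
  have s4 := abs_le.mp huw
  rw [hexp]
  refine abs_le.mpr ⟨?_, ?_⟩ <;> linarith

end

section

/-! ### The error of a single entry -/

variable {n d p : ℕ}

lemma dotProduct_mulVec_mulVec_gram (B : Matrix (Fin d) (Fin p) ℝ) (x y : Fin p → ℝ) :
    (B *ᵥ x) ⬝ᵥ (B *ᵥ y) = x ⬝ᵥ (Bᵀ * B) *ᵥ y := by
  rw [← Matrix.mulVec_mulVec, Matrix.dotProduct_mulVec x, Matrix.vecMul_transpose]

lemma mulVec_vecMul_gram (B : Matrix (Fin d) (Fin p) ℝ) (c : Fin p → ℝ) :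
    (B *ᵥ c) ᵥ* B = (Bᵀ * B) *ᵥ c := by
  rw [← Matrix.mulVec_mulVec, Matrix.mulVec_transpose]

lemma isHermitian_gram (B : Matrix (Fin d) (Fin p) ℝ) : (Bᵀ * B).IsHermitian := by
  simpa [Matrix.conjTranspose_eq_transpose_of_trivial] using Matrix.isHermitian_conjTranspose_mul_self B

lemma four_mul_transpose_mul_empMoment_mul (B : Matrix (Fin d) (Fin p) ℝ) (Y : Fin n → Fin d → ℝ)
    (i j : Fin p) :
    4 * (Bᵀ * empMoment Y * B) i j
      = (n : ℝ)⁻¹ * ∑ s, ((B *ᵥ pairVec i j 1) ⬝ᵥ Y s) ^ 2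
        - (n : ℝ)⁻¹ * ∑ s, ((B *ᵥ pairVec i j (-1)) ⬝ᵥ Y s) ^ 2 := by
  have h : (Bᵀ * empMoment Y * B) i j
      = (n : ℝ)⁻¹ * ∑ s, (B.col i ⬝ᵥ Y s) * (B.col j ⬝ᵥ Y s) := by
    have h1 : (Bᵀ * empMoment Y * B) i j = B.col i ⬝ᵥ empMoment Y *ᵥ B.col j := by
      rw [Matrix.mul_assoc, Matrix.mul_apply']
      rfl
    rw [h1, empMoment, Matrix.smul_mulVec, Matrix.sum_mulVec, dotProduct_smul, dotProduct_sum,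
      smul_eq_mul]
    congr 1
    refine Finset.sum_congr rfl fun s _ => ?_
    rw [Matrix.vecMulVec_mulVec, dotProduct_comm (B.col j)]
    simp [dotProduct_smul, mul_comm]
  rw [h, ← mul_sub, ← Finset.sum_sub_distrib, mul_left_comm, Finset.mul_sum]
  congr 1
  refine Finset.sum_congr rfl fun s _ => ?_
  simp only [mulVec_pairVec, add_dotProduct, smul_dotProduct, smul_eq_mul]
  ring

/-- Population counterpart of `four_mul_transpose_mul_empMoment_mul`; it separates the signal from
the noise contribution. -/
lemma pairVar_sub_pairVar {g S : Matrix (Fin p) (Fin p) ℝ} (hg : g.IsHermitian)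
    (hS : S.IsHermitian) (σ : ℝ) (i j : Fin p) :
    pairVar g S σ i j 1 - pairVar g S σ i j (-1)
      = 4 * (g.col i ⬝ᵥ S *ᵥ g.col j + σ ^ 2 * g i j) := by
  unfold pairVar
  rw [pairVec_quadForm hg, pairVec_quadForm hg, mulVec_pairVec, mulVec_pairVec,
    quadForm_add_smul hS, quadForm_add_smul hS]
  ring

/-- The error analysis yields only the terms listed in `hx`. The factors `1 + p/d` and the term
`L√p/√(nd)` of `tauInf` are slack. -/
lemma le_tauInf {C x : ℝ} (hC : 0 ≤ C) (hn : 0 < n) (hd : 0 < d)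
    (hL : 0 ≤ Real.log p) (S : Matrix (Fin p) (Fin p) ℝ) (σ : ℝ≥0)
    (hx : x ≤ C * (√(Real.log p / n) + √(Real.log p / d) * maxColNorm S
      + Real.log p / d * offFrobNorm S + √(Real.log p / n) * (p * Real.log p / d)
      + √(p * Real.log p) / d + p * √(Real.log p / d) / d
      + (σ : ℝ) ^ 2 * √(Real.log p / d) + (σ : ℝ) ^ 2 * √(Real.log p / n))) :
    x ≤ tauInf C n d p S σ := by
  refine hx.trans ?_
  unfold tauInf
  simp only []
  set L := Real.log p
  have hn' : (0 : ℝ) < n := Nat.cast_pos.mpr hn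
  have hd' : (0 : ℝ) < d := Nat.cast_pos.mpr hd
  have hF : 0 ≤ offFrobNorm S := Real.sqrt_nonneg _
  have hpow : ∀ x : ℝ, 0 ≤ x → x ^ (3 / 2 : ℝ) = x * √x := by
    intro x hx
    rw [show (3 / 2 : ℝ) = 1 + 1 / 2 by norm_num, Real.rpow_add' hx (by norm_num), Real.rpow_one,
      Real.sqrt_eq_rpow]
  have hpd : (1 : ℝ) ≤ 1 + p / d := le_add_of_nonneg_right (by positivity)
  have e3 : L / d * offFrobNorm S ≤ L / d * (1 + p / d) * offFrobNorm S := by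
    gcongr
    exact le_mul_of_one_le_right (by positivity) hpd
  have e4 : 0 ≤ L * √p / √(n * d) := by positivity
  have e5 : √(L / n) * (p * L / d) ≤ p * L ^ (3 / 2 : ℝ) / (√n * d) * (1 + p / d) := by
    refine le_trans (le_of_eq ?_) (le_mul_of_one_le_right (by positivity) hpd)
    rw [hpow L hL, Real.sqrt_div hL]
    field_simp
  have e7 : p * √(L / d) / d = p * √L / (d : ℝ) ^ (3 / 2 : ℝ) := by
    rw [hpow d hd'.le, Real.sqrt_div hL]
    field_simp
  have e8 : (σ : ℝ) ^ 2 * √(L / d) + (σ : ℝ) ^ 2 * √(L / n)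
      ≤ (σ : ℝ) ^ 2 * (1 + √(L / d)) * √(L / d) * (1 + max √((d : ℝ) / n) ((d : ℝ) / n)) := by
    -- The sampling error of the noise is absorbed by the factor containing `√(d/n)`.
    have ha : √(L / n) = √(L / d) * √((d : ℝ) / n) := by
      rw [← Real.sqrt_mul (by positivity)]
      congr 1
      field_simp
    calc (σ : ℝ) ^ 2 * √(L / d) + (σ : ℝ) ^ 2 * √(L / n)
        = (σ : ℝ) ^ 2 * 1 * √(L / d) * (1 + √((d : ℝ) / n)) := by rw [ha]; ring
      _ ≤ _ := by
        gcongr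
        · exact le_add_of_nonneg_right (Real.sqrt_nonneg _)
        · exact le_max_left _ _
  refine mul_le_mul_of_nonneg_left ?_ hC
  rw [← e7]
  linarith

lemma abs_entry_error_le_tauInf {K : ℝ} (hK : 0 ≤ K) (hn : 0 < n) (hd : 0 < d)
    (hL : 1 ≤ Real.log p) (hLd : Real.log p ≤ d) (hLp : Real.log p ≤ p)
    {S : Matrix (Fin p) (Fin p) ℝ} (hS : S.PosSemidef) (h1 : ∀ i, S i i = 1) (σ : ℝ≥0)
    (B : Matrix (Fin d) (Fin p) ℝ) (Y : Fin n → Fin d → ℝ) {i j : Fin p} (hij : i ≠ j) {q : ℝ}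
    (hq0 : 0 ≤ q) (hq : q ≤ p)
    (hE : ∀ a b, |(Bᵀ * B) a b - (1 : Matrix (Fin p) (Fin p) ℝ) a b| ≤ 40 * √(Real.log p / d))
    (hES : ∀ a b, |(Bᵀ * B * S) a b - S a b| ≤ 40 * √(Real.log p / d) * maxColNorm S)
    (hQ : ∀ τ : ℝ, |τ| = 1 →
      |eraseOn {i, j} ((Bᵀ * B) *ᵥ pairVec i j τ)
          ⬝ᵥ offDiag S *ᵥ eraseOn {i, j} ((Bᵀ * B) *ᵥ pairVec i j τ)|
      ≤ pairVec i j τ ⬝ᵥ (Bᵀ * B) *ᵥ pairVec i j τ * (d : ℝ)⁻¹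
        * (20 * Real.log p * offFrobNorm S))
    (hN : ∀ τ : ℝ, |τ| = 1 →
      |eraseOn {i, j} ((Bᵀ * B) *ᵥ pairVec i j τ) ⬝ᵥ eraseOn {i, j} ((Bᵀ * B) *ᵥ pairVec i j τ)
        - q * (pairVec i j τ ⬝ᵥ (Bᵀ * B) *ᵥ pairVec i j τ * (d : ℝ)⁻¹)|
      ≤ pairVec i j τ ⬝ᵥ (Bᵀ * B) *ᵥ pairVec i j τ * (d : ℝ)⁻¹ * (40 * √(p * Real.log p)))
    (hY : ∀ τ : ℝ, |τ| = 1 →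
      |(n : ℝ)⁻¹ * ∑ s, ((B *ᵥ pairVec i j τ) ⬝ᵥ Y s) ^ 2 - pairVar (Bᵀ * B) S σ i j τ|
      ≤ 20 * (1 + K) * √(Real.log p / n) * pairVar (Bᵀ * B) S σ i j τ) :
    |(d : ℝ) / (d + 1) * (Bᵀ * empMoment Y * B) i j - S i j|
      ≤ tauInf (600000 * (1 + K) + 13000) n d p S σ := by
  have hn' : (0 : ℝ) < n := Nat.cast_pos.mpr hn
  have hd' : (0 : ℝ) < d := Nat.cast_pos.mpr hd
  have hd1 : (1 : ℝ) ≤ d := Nat.one_le_cast.mpr hd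
  have hg := isHermitian_gram B
  have hβ : ∀ τ : ℝ, 0 ≤ pairVec i j τ ⬝ᵥ (Bᵀ * B) *ᵥ pairVec i j τ := fun τ => by
    rw [← dotProduct_mulVec_mulVec_gram]; exact dotProduct_self_nonneg' _
  have hemp := four_mul_transpose_mul_empMoment_mul B Y i j
  have hm := one_le_maxColNorm h1 i
  set g := Bᵀ * B
  set L := Real.log p
  set m := maxColNorm S
  set r := √(L / d) with hr
  have hr0 : 0 ≤ r := Real.sqrt_nonneg _
  have hr1 : r ≤ 1 := Real.sqrt_le_one.mpr (by rwa [div_le_one hd'])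
  have hG := fun τ hτ => pairVar_le hg hS h1 hL hLp hd' (by linarith) hq hE hij σ hτ (hβ τ)
    (hQ τ hτ) (hN τ hτ)
  have hbias := abs_gram_bilin_sub_le hg hS h1 hd' (by positivity) (by linarith) hm
    (by linarith) hq0 hq hE hES hij hQ hN
  have hdiff := pairVar_sub_pairVar hg hS.1 (σ : ℝ) i j
  have hgij := hE i j
  rw [Matrix.one_apply_ne hij, sub_zero] at hgij
  have hY1 := hY 1 (by simp)
  have hY2 := hY (-1) (by simp)
  have hG1 := hG 1 (by simp)
  have hG2 := hG (-1) (by simp)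
  set a := √(L / n)
  have ha0 : 0 ≤ a := Real.sqrt_nonneg _
  set x := (Bᵀ * empMoment Y * B) i j
  set W := 1 + p * L / d + (σ : ℝ) ^ 2 with hW
  have hKa : 0 ≤ 20 * (1 + K) * a := by positivity
  have hY1' := abs_le.mp (hY1.trans (mul_le_mul_of_nonneg_left hG1 hKa))
  have hY2' := abs_le.mp (hY2.trans (mul_le_mul_of_nonneg_left hG2 hKa))
  have hnoise : |(σ : ℝ) ^ 2 * g i j| ≤ (σ : ℝ) ^ 2 * (40 * r) := by
    rw [abs_mul, abs_of_nonneg (sq_nonneg _)]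
    gcongr
  -- Polarization averages two sampling errors: `2 · 20(1+K) · 60000 / 4 = 600000(1+K)`.
  have hxS : |x - S i j| ≤ 600000 * (1 + K) * a * W + (322 * (40 * r) * m
      + 1640 * (L / d * offFrobNorm S) + 3280 * (√(p * L) / d) + p * (40 * r) / d)
      + (σ : ℝ) ^ 2 * (40 * r) := by
    have hb := abs_le.mp hbias
    have hs := abs_le.mp hnoise
    refine abs_le.mpr ⟨?_, ?_⟩ <;> linarith
  -- Because `L ≥ 1`, the shrinkage `d/(d+1)` changes the target by no more than an error term
  -- already present. The total coefficient of `r * m` is then `322·40 + 1 ≤ 13000`.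
  have hinv : 1 / ((d : ℝ) + 1) ≤ r * m := by
    have h2 : 1 / ((d : ℝ) + 1) ≤ r := by
      refine Real.le_sqrt_of_sq_le ?_
      rw [div_pow, div_le_div_iff₀ (by positivity) hd']
      nlinarith
    exact h2.trans (le_mul_of_one_le_right hr0 hm)
  have hdec : (d : ℝ) / (d + 1) * x - S i j
      = (d : ℝ) / (d + 1) * (x - S i j) - 1 / ((d : ℝ) + 1) * S i j := by
    field_simp
    ring
  have hS1 := abs_apply_le_one hS h1 i j
  have htot : |(d : ℝ) / (d + 1) * x - S i j| ≤ |x - S i j| + r * m := by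
    rw [hdec]
    refine (abs_sub _ _).trans (add_le_add ?_ ?_)
    · rw [abs_mul, abs_of_nonneg (by positivity)]
      refine mul_le_of_le_one_left (abs_nonneg _) ?_
      rw [div_le_one (by positivity)]
      linarith
    · rw [abs_mul, abs_of_nonneg (by positivity)]
      refine (mul_le_of_le_one_right (by positivity) hS1).trans hinv
  refine le_tauInf (by positivity) hn hd (by linarith) S σ ?_
  refine htot.trans ((add_le_add_left hxS _).trans ?_)
  have hF : 0 ≤ offFrobNorm S := Real.sqrt_nonneg _
  have t1 : 0 ≤ r * m := by positivity
  have t2 : 0 ≤ L / d * offFrobNorm S := by positivity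
  have t3 : 0 ≤ √(p * L) / d := by positivity
  have t4 : 0 ≤ p * r / d := by positivity
  have t5 : 0 ≤ (σ : ℝ) ^ 2 * r := by positivity
  have t6 : 0 ≤ a * (p * L / d) := by positivity
  have t7 : 0 ≤ (σ : ℝ) ^ 2 * a := by positivity
  have hKt : 0 ≤ 600000 * (1 + K) *
      (r * m + L / d * offFrobNorm S + √(p * L) / d + p * r / d + (σ : ℝ) ^ 2 * r) := by positivity
  have e1 : p * (40 * r) / d = 40 * (p * r / d) := by ring
  rw [e1, hW]
  linarith

end

/-! ### Probability of the good event -/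

/-- An inequality is all that is needed, and it holds without measurability of `s`. -/
lemma measureReal_preimage_le_of_hasLaw {Ω α : Type*} [MeasurableSpace Ω] [MeasurableSpace α]
    {P : Measure Ω} {μ : Measure α} [IsFiniteMeasure μ] {Z : Ω → α} (hZ : HasLaw Z μ P)
    (s : Set α) : P.real (Z ⁻¹' s) ≤ μ.real s := by
  rw [measureReal_def, measureReal_def]
  refine ENNReal.toReal_mono (measure_ne_top _ _) ?_
  rw [← hZ.map_eq]
  exact Measure.le_map_apply hZ.aemeasurable s

instance isProbabilityMeasure_modelLaw (n d p : ℕ) (S : Matrix (Fin p) (Fin p) ℝ) (σ : ℝ≥0) :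
    IsProbabilityMeasure (modelLaw n d p S σ) := by
  unfold modelLaw; infer_instance

lemma measurable_pairVar {α : Type*} [MeasurableSpace α] {d p : ℕ} {f : α → Fin d → Fin p → ℝ}
    (hf : Measurable f) (S : Matrix (Fin p) (Fin p) ℝ) (σ : ℝ) (i j : Fin p) (τ : ℝ) :
    Measurable fun a => pairVar ((Matrix.of (f a))ᵀ * Matrix.of (f a)) S σ i j τ := by
  have h1 : Measurable fun a => Matrix.of (f a) *ᵥ pairVec i j τ :=
    measurable_mulVec hf measurable_const
  have h2 := measurable_vecMul hf h1
  have h3 := measurable_dotProduct h2 (measurable_mulVec (f := fun _ => S) measurable_const h2)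
  have h4 := measurable_dotProduct h1 h1
  simp only [pairVar, ← dotProduct_mulVec_mulVec_gram]
  simp only [← mulVec_vecMul_gram]
  exact h3.add (h4.mul_const _)

section

variable {n d p : ℕ} {S : Matrix (Fin p) (Fin p) ℝ} {σ : ℝ≥0} {Ω : Type*} [MeasurableSpace Ω]
  {P : Measure Ω} {A : Ω → Fin d → Fin p → ℝ}
  {X : Ω → Fin n → EuclideanSpace ℝ (Fin p)} {W : Ω → Fin n → Fin d → ℝ}

lemma hasLaw_sensing (h : HasLaw (fun ω => (A ω, X ω, W ω)) (modelLaw n d p S σ) P) :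
    HasLaw A (sensingLaw d p) P :=
  HasLaw.comp (X := fun ω => (A ω, X ω, W ω)) (Y := Prod.fst)
    ⟨by fun_prop, by unfold modelLaw; exact measurePreserving_fst.map_eq⟩ h

lemma real_gram_bad_le (h : HasLaw (fun ω => (A ω, X ω, W ω)) (modelLaw n d p S σ) P)
    (hd : 0 < d) {L : ℝ} (hL : 0 ≤ L) (hLd : L ≤ d) (i j : Fin p) :
    P.real {ω | 40 * √(L / d) < |((Matrix.of (A ω))ᵀ * Matrix.of (A ω)) i j
      - (1 : Matrix (Fin p) (Fin p) ℝ) i j|} ≤ 4 * Real.exp (-(4 * L)) := by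
  have h1 : ∀ k : Fin p, (Pi.single k 1 : Fin p → ℝ) ⬝ᵥ Pi.single k 1 ≤ 1 := fun k => by simp
  refine le_trans (le_of_eq ?_) ((measureReal_preimage_le_of_hasLaw (hasLaw_sensing h) _).trans
    (sensing_inner_tail_unit hd hL hLd (h1 i) (h1 j)))
  congr 1
  ext ω
  simp only [Set.mem_preimage, Set.mem_ofPred_eq, dotProduct_mulVec_mulVec_gram]
  simp [single_dotProduct, Matrix.one_apply, Pi.single_apply, eq_comm (a := j)]

lemma real_gram_mul_bad_le (h : HasLaw (fun ω => (A ω, X ω, W ω)) (modelLaw n d p S σ) P)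
    (hS : ∀ i, S i i = 1)
    (hd : 0 < d) {L : ℝ} (hL : 0 ≤ L) (hLd : L ≤ d) (i j : Fin p) :
    P.real {ω | 40 * √(L / d) * maxColNorm S < |((Matrix.of (A ω))ᵀ * Matrix.of (A ω) * S) i j
      - S i j|} ≤ 4 * Real.exp (-(4 * L)) := by
  have h1 : (Pi.single i 1 : Fin p → ℝ) ⬝ᵥ Pi.single i 1 ≤ 1 := by simp
  have h2 : S.col j ⬝ᵥ S.col j ≤ maxColNorm S ^ 2 := by
    simpa [dotProduct, sq] using column_sq_le_maxColNorm_sq S j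
  refine le_trans (le_of_eq ?_) ((measureReal_preimage_le_of_hasLaw (hasLaw_sensing h) _).trans
    (sensing_inner_tail hd hL hLd h1 (zero_lt_one.trans_le (one_le_maxColNorm hS j)) h2))
  congr 1
  ext ω
  simp only [Set.mem_preimage, Set.mem_ofPred_eq, dotProduct_mulVec_mulVec_gram, single_dotProduct,
    one_mul, Matrix.col_apply]
  rfl

lemma real_quadForm_bad_le (h : HasLaw (fun ω => (A ω, X ω, W ω)) (modelLaw n d p S σ) P)
    (hS : S.IsHermitian) {L : ℝ} (hL : 1 ≤ L) (i j : Fin p) (τ : ℝ) :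
    P.real {ω | pairVec i j τ ⬝ᵥ ((Matrix.of (A ω))ᵀ * Matrix.of (A ω)) *ᵥ pairVec i j τ * (d : ℝ)⁻¹
        * (20 * L * offFrobNorm S)
      < |eraseOn {i, j} (((Matrix.of (A ω))ᵀ * Matrix.of (A ω)) *ᵥ pairVec i j τ) ⬝ᵥ
        offDiag S *ᵥ eraseOn {i, j} (((Matrix.of (A ω))ᵀ * Matrix.of (A ω)) *ᵥ pairVec i j τ)|}
      ≤ 2 * Real.exp (-(4 * L)) := by
  have := (measureReal_preimage_le_of_hasLaw (hasLaw_sensing h) _).trans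
    (sensing_gram_quadForm_tail (d := d) hL {i, j} (fun k hk => pairVec_eq_zero τ hk) hS)
  simpa only [Set.preimage_ofPred_eq, dotProduct_mulVec_mulVec_gram, mulVec_vecMul_gram] using this

lemma real_norm_bad_le (h : HasLaw (fun ω => (A ω, X ω, W ω)) (modelLaw n d p S σ) P)
    (hp : 0 < p) {L : ℝ} (hL : 0 ≤ L) (hLp : L ≤ p) (i j : Fin p) (τ : ℝ) :
    P.real {ω | pairVec i j τ ⬝ᵥ ((Matrix.of (A ω))ᵀ * Matrix.of (A ω)) *ᵥ pairVec i j τ * (d : ℝ)⁻¹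
        * (40 * √(p * L))
      < |eraseOn {i, j} (((Matrix.of (A ω))ᵀ * Matrix.of (A ω)) *ᵥ pairVec i j τ) ⬝ᵥ
        eraseOn {i, j} (((Matrix.of (A ω))ᵀ * Matrix.of (A ω)) *ᵥ pairVec i j τ)
        - (∑ k, if k ∈ ({i, j} : Finset (Fin p)) then (0 : ℝ) else 1) *
          (pairVec i j τ ⬝ᵥ ((Matrix.of (A ω))ᵀ * Matrix.of (A ω)) *ᵥ pairVec i j τ
            * (d : ℝ)⁻¹)|}
      ≤ 2 * Real.exp (-(4 * L)) := by
  have := (measureReal_preimage_le_of_hasLaw (hasLaw_sensing h) _).trans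
    (sensing_gram_norm_tail (d := d) hp hL hLp {i, j} (fun k hk => pairVec_eq_zero τ hk))
  simpa only [Set.preimage_ofPred_eq, dotProduct_mulVec_mulVec_gram, mulVec_vecMul_gram] using this

lemma real_moment_bad_le (h : HasLaw (fun ω => (A ω, X ω, W ω)) (modelLaw n d p S σ) P)
    (hS : S.PosSemidef) {L K : ℝ} (hn : 0 < n) (hL : 0 ≤ L) (hK : 0 ≤ K) (hLn : L ≤ K * n)
    (i j : Fin p) (τ : ℝ) :
    P.real {ω | 20 * (1 + K) * √(L / n)
        * pairVar ((Matrix.of (A ω))ᵀ * Matrix.of (A ω)) S σ i j τ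
      < |(n : ℝ)⁻¹ * ∑ s, ((Matrix.of (A ω) *ᵥ pairVec i j τ) ⬝ᵥ obs (A ω) (X ω) (W ω) s) ^ 2
        - pairVar ((Matrix.of (A ω))ᵀ * Matrix.of (A ω)) S σ i j τ|}
      ≤ 2 * Real.exp (-(4 * L)) := by
  set s : Set ((Fin d → Fin p → ℝ) × (Fin n → EuclideanSpace ℝ (Fin p)) × (Fin n → Fin d → ℝ)) :=
    {q | 20 * (1 + K) * √(L / n)
        * pairVar ((Matrix.of q.1)ᵀ * Matrix.of q.1) S σ i j τ
      < |(n : ℝ)⁻¹ * ∑ s, ((Matrix.of q.1 *ᵥ pairVec i j τ) ⬝ᵥ obs q.1 q.2.1 q.2.2 s) ^ 2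
        - pairVar ((Matrix.of q.1)ᵀ * Matrix.of q.1) S σ i j τ|} with hs
  have hmeas : MeasurableSet s := by
    have h1 := measurable_pairVar (α := (Fin d → Fin p → ℝ) ×
      (Fin n → EuclideanSpace ℝ (Fin p)) × (Fin n → Fin d → ℝ)) measurable_fst S σ i j τ
    have h2 : ∀ t, Measurable fun q : (Fin d → Fin p → ℝ) ×
        (Fin n → EuclideanSpace ℝ (Fin p)) × (Fin n → Fin d → ℝ) =>
        (Matrix.of q.1 *ᵥ pairVec i j τ) ⬝ᵥ obs q.1 q.2.1 q.2.2 t := fun t => by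
      refine measurable_dotProduct (measurable_mulVec measurable_fst measurable_const) ?_
      exact (measurable_mulVec measurable_fst (by fun_prop)).add (by fun_prop)
    exact measurableSet_lt (by fun_prop) (by fun_prop)
  refine (measureReal_preimage_le_of_hasLaw h s).trans ?_
  unfold modelLaw
  refine prod_real_le_of_forall hmeas fun B => ?_
  refine obs_second_moment_tail hS σ hn hL hK hLn B (Matrix.of B *ᵥ pairVec i j τ)
    (G := pairVar ((Matrix.of B)ᵀ * Matrix.of B) S σ i j τ) ?_
  rw [pairVar, mulVec_vecMul_gram, dotProduct_mulVec_mulVec_gram]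

lemma measureReal_union_le_of_le {s t : Set Ω} {a b : ℝ} (hs : P.real s ≤ a) (ht : P.real t ≤ b) :
    P.real (s ∪ t) ≤ a + b :=
  (measureReal_union_le s t).trans (add_le_add hs ht)

lemma maxNorm_error_prob [IsProbabilityMeasure P] {K : ℝ} (hK : 0 ≤ K) (hn : 0 < n) (hd : 0 < d) (hp : 0 < p)
    (hL : 1 ≤ Real.log p) (hLd : Real.log p ≤ d) (hLn : Real.log p ≤ K * n)
    (hS : S.PosSemidef) (h1 : ∀ i, S i i = 1)
    (h : HasLaw (fun ω => (A ω, X ω, W ω)) (modelLaw n d p S σ) P) :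
    1 - 20 * (p : ℝ) ^ 2 * Real.exp (-(4 * Real.log p)) ≤
      P.real {ω | maxNorm (covEstimator (A ω) (obs (A ω) (X ω) (W ω)) - S)
        ≤ tauInf (600000 * (1 + K) + 13000) n d p S σ} := by
  have hL0 : 0 ≤ Real.log p := zero_le_one.trans hL
  have hLp : Real.log p ≤ p := Real.log_le_self (by positivity)
  set E := {ω | maxNorm (covEstimator (A ω) (obs (A ω) (X ω) (W ω)) - S)
        ≤ tauInf (600000 * (1 + K) + 13000) n d p S σ} with hE
  -- One bad set per ordered pair, including `i = j` since all Gram entries are used. The constant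
  -- is `20 = 4 + 4 + 2(2 + 2 + 2)`, the last factor counting the events for each `τ = ±1`.
  have hbad : ∀ ij : Fin p × Fin p, ∃ B : Set Ω, P.real B ≤ 20 * Real.exp (-(4 * Real.log p)) ∧
      ∀ ω, ω ∉ B →
        |((Matrix.of (A ω))ᵀ * Matrix.of (A ω)) ij.1 ij.2
          - (1 : Matrix (Fin p) (Fin p) ℝ) ij.1 ij.2| ≤ 40 * √(Real.log p / d) ∧
        |((Matrix.of (A ω))ᵀ * Matrix.of (A ω) * S) ij.1 ij.2 - S ij.1 ij.2|
          ≤ 40 * √(Real.log p / d) * maxColNorm S ∧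
        ∀ τ : ℝ, |τ| = 1 →
          |eraseOn {ij.1, ij.2} (((Matrix.of (A ω))ᵀ * Matrix.of (A ω)) *ᵥ pairVec ij.1 ij.2 τ) ⬝ᵥ
            offDiag S *ᵥ
              eraseOn {ij.1, ij.2} (((Matrix.of (A ω))ᵀ * Matrix.of (A ω)) *ᵥ pairVec ij.1 ij.2 τ)|
            ≤ pairVec ij.1 ij.2 τ ⬝ᵥ ((Matrix.of (A ω))ᵀ * Matrix.of (A ω)) *ᵥ pairVec ij.1 ij.2 τ
              * (d : ℝ)⁻¹ * (20 * Real.log p * offFrobNorm S) ∧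
          |eraseOn {ij.1, ij.2} (((Matrix.of (A ω))ᵀ * Matrix.of (A ω)) *ᵥ pairVec ij.1 ij.2 τ) ⬝ᵥ
              eraseOn {ij.1, ij.2} (((Matrix.of (A ω))ᵀ * Matrix.of (A ω)) *ᵥ pairVec ij.1 ij.2 τ)
            - (∑ k, if k ∈ ({ij.1, ij.2} : Finset (Fin p)) then (0 : ℝ) else 1) *
              (pairVec ij.1 ij.2 τ ⬝ᵥ
                ((Matrix.of (A ω))ᵀ * Matrix.of (A ω)) *ᵥ pairVec ij.1 ij.2 τ * (d : ℝ)⁻¹)|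
            ≤ pairVec ij.1 ij.2 τ ⬝ᵥ ((Matrix.of (A ω))ᵀ * Matrix.of (A ω)) *ᵥ pairVec ij.1 ij.2 τ
              * (d : ℝ)⁻¹ * (40 * √(p * Real.log p)) ∧
          |(n : ℝ)⁻¹ * ∑ s, ((Matrix.of (A ω) *ᵥ pairVec ij.1 ij.2 τ) ⬝ᵥ
                obs (A ω) (X ω) (W ω) s) ^ 2
            - pairVar ((Matrix.of (A ω))ᵀ * Matrix.of (A ω)) S σ ij.1 ij.2 τ|
            ≤ 20 * (1 + K) * √(Real.log p / n)
              * pairVar ((Matrix.of (A ω))ᵀ * Matrix.of (A ω)) S σ ij.1 ij.2 τ := by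
    rintro ⟨i, j⟩
    have hτ := fun τ : ℝ => measureReal_union_le_of_le (real_quadForm_bad_le h hS.1 hL i j τ)
      (measureReal_union_le_of_le (real_norm_bad_le h hp hL0 hLp i j τ)
        (real_moment_bad_le h hS hn hL0 hK hLn i j τ))
    refine ⟨_, (measureReal_union_le_of_le (real_gram_bad_le h hd hL0 hLd i j)
      (measureReal_union_le_of_le (real_gram_mul_bad_le h h1 hd hL0 hLd i j)
        (measureReal_union_le_of_le (hτ 1) (hτ (-1))))).trans (by linarith), fun ω hω => ?_⟩
    simp only [Set.mem_union, Set.mem_ofPred_eq, not_or, not_lt] at hω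
    obtain ⟨g1, g2, g3, g4⟩ := hω
    refine ⟨g1, g2, fun τ hτ => ?_⟩
    rcases (abs_eq zero_le_one).mp hτ with rfl | rfl
    · exact g3
    · exact g4
  choose B hB hgood using hbad
  have hunion : P.real (⋃ ij, B ij) ≤ 20 * (p : ℝ) ^ 2 * Real.exp (-(4 * Real.log p)) := by
    refine (measureReal_iUnion_fintype_le B).trans ((Finset.sum_le_sum fun ij _ => hB ij).trans ?_)
    simp only [Finset.sum_const, Finset.card_univ, Fintype.card_prod, Fintype.card_fin,
      nsmul_eq_mul, Nat.cast_mul]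
    exact le_of_eq (by ring)
  -- Covering the whole space by `E` and the bad sets bounds the probability of `E` below without
  -- showing that `E` is measurable.
  have hcover : (Set.univ : Set Ω) ⊆ E ∪ ⋃ ij, B ij := by
    intro ω _
    by_cases hω : ω ∈ ⋃ ij, B ij
    · exact Or.inr hω
    refine Or.inl ?_
    simp only [Set.mem_iUnion, not_exists] at hω
    have hg := fun ij => hgood ij ω (hω ij)
    have hτ0 : 0 ≤ tauInf (600000 * (1 + K) + 13000) n d p S σ := by
      refine le_tauInf (by positivity) hn hd hL0 S σ ?_
      have := maxColNorm_nonneg S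
      have : 0 ≤ offFrobNorm S := Real.sqrt_nonneg _
      positivity
    refine Real.iSup_le (fun i => Real.iSup_le (fun j => ?_) hτ0) hτ0
    by_cases hij : i = j
    · subst hij
      simpa [covEstimator, offDiag, h1] using hτ0
    · have hentry : (covEstimator (A ω) (obs (A ω) (X ω) (W ω)) - S) i j
          = (d : ℝ) / (d + 1) * ((Matrix.of (A ω))ᵀ * empMoment (obs (A ω) (X ω) (W ω))
            * Matrix.of (A ω)) i j - S i j := by
        simp [covEstimator, offDiag, hij]
      rw [hentry]
      refine abs_entry_error_le_tauInf hK hn hd hL hLd hLp hS h1 σ (Matrix.of (A ω)) _ hij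
        (q := ∑ k, if k ∈ ({i, j} : Finset (Fin p)) then (0 : ℝ) else 1)
        (Finset.sum_nonneg fun k _ => by split_ifs <;> simp) ?_ (fun a b => (hg (a, b)).1)
        (fun a b => (hg (a, b)).2.1) (fun τ hτ => ((hg (i, j)).2.2 τ hτ).1)
        (fun τ hτ => ((hg (i, j)).2.2 τ hτ).2.1) (fun τ hτ => ((hg (i, j)).2.2 τ hτ).2.2)
      calc ∑ k, (if k ∈ ({i, j} : Finset (Fin p)) then (0 : ℝ) else 1) ≤ ∑ _k : Fin p, (1 : ℝ) :=
            Finset.sum_le_sum fun k _ => by split_ifs <;> simp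
        _ = p := by simp
  have h2 := (measureReal_mono hcover (μ := P)).trans (measureReal_union_le _ _)
  rw [probReal_univ] at h2
  linarith

end

end IndirectCov

/-! ### The theorem: choice of constants and trivial regimes -/

theorem mainTheorem2 (K : ℝ) (hK : 0 < K) :
    ∃ c₀ c₁ c₂ c₃ c₄ C : ℝ, 0 < c₀ ∧ 0 < c₁ ∧ 0 < c₂ ∧ 0 < c₃ ∧ 0 < c₄ ∧ 0 < C ∧
      ∀ (n d p : ℕ), 0 < n → 0 < d → 0 < p → Real.log p ≤ K * n →
      ∀ (S : Matrix (Fin p) (Fin p) ℝ), S.PosSemidef → (∀ i, S i i = 1) →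
      ∀ (σ : ℝ≥0) (Ω : Type*) [MeasurableSpace Ω] (P : Measure Ω) [IsProbabilityMeasure P]
        (A : Ω → Fin d → Fin p → ℝ) (X : Ω → Fin n → EuclideanSpace ℝ (Fin p))
        (W : Ω → Fin n → Fin d → ℝ),
      HasLaw (fun ω => (A ω, X ω, W ω)) (IndirectCov.modelLaw n d p S σ) P →
      1 - c₀ * (p : ℝ)⁻¹ - c₁ * (p : ℝ) ^ 2 * Real.exp (-(c₂ * d))
          - c₃ * (p : ℝ) ^ 2 * Real.exp (-(c₄ * p)) ≤
        P.real {ω | IndirectCov.maxNorm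
          (IndirectCov.covEstimator (A ω) (IndirectCov.obs (A ω) (X ω) (W ω)) - S)
            ≤ IndirectCov.tauInf C n d p S σ} := by
  refine ⟨20, 1, 1, 1, 1, 600000 * (1 + K) + 13000, by norm_num, by norm_num, by norm_num,
    by norm_num, by norm_num, by positivity, ?_⟩
  intro n d p hn hd hp hLn S hS h1 σ Ω _ P _ A X W h
  have hp' : (0 : ℝ) < p := Nat.cast_pos.mpr hp
  have hp1 : (1 : ℝ) ≤ p := Nat.one_le_cast.mpr hp
  have t0 : 0 ≤ 20 * (p : ℝ)⁻¹ := by positivity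
  have t1 : 0 ≤ 1 * (p : ℝ) ^ 2 * Real.exp (-(1 * d)) := by positivity
  have t2 : 0 ≤ 1 * (p : ℝ) ^ 2 * Real.exp (-(1 * p)) := by positivity
  by_cases hp3 : p < 3
  -- For `p ≤ 2` the term `20/p` alone exceeds `1`; for `p ≥ 3 > e` one has `log p ≥ 1`.
  · have hp2 : (p : ℝ) ≤ 2 := by exact_mod_cast Nat.lt_succ_iff.mp hp3
    have : 1 ≤ 20 * (p : ℝ)⁻¹ := by
      rw [← div_eq_mul_inv, le_div_iff₀ hp']
      linarith
    exact le_trans (by linarith) measureReal_nonneg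
  have hL : 1 ≤ Real.log p := by
    have hp3' : (3 : ℝ) ≤ p := by exact_mod_cast not_lt.mp hp3
    rw [Real.le_log_iff_exp_le hp']
    linarith [Real.exp_one_lt_d9]
  by_cases hLd : Real.log p ≤ d
  · have hmain := IndirectCov.maxNorm_error_prob hK.le hn hd hp hL hLd hLn hS h1 h
    have hexp : Real.exp (-(4 * Real.log p)) = ((p : ℝ) ^ 4)⁻¹ := by
      rw [Real.exp_neg, mul_comm, Real.exp_mul, Real.exp_log hp']
      norm_cast
    -- The union bound gives `20 p² · p⁻⁴`, more than enough.
    have hfin : 20 * (p : ℝ) ^ 2 * Real.exp (-(4 * Real.log p)) ≤ 20 * (p : ℝ)⁻¹ := by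
      rw [hexp, ← div_eq_mul_inv, ← div_eq_mul_inv, div_le_div_iff₀ (by positivity) hp']
      have : (p : ℝ) ^ 3 ≤ (p : ℝ) ^ 4 := pow_le_pow_right₀ hp1 (by norm_num)
      linarith
    linarith
  -- If `d < log p` then `e⁻ᵈ ≥ 1/p`, so `p² e⁻ᵈ ≥ p ≥ 1` and the claimed lower bound is not
  -- positive.
  · have : 1 ≤ 1 * (p : ℝ) ^ 2 * Real.exp (-(1 * d)) := by
      have hlow : (p : ℝ)⁻¹ ≤ Real.exp (-(1 * d)) := by
        rw [← Real.exp_log hp', ← Real.exp_neg]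
        exact Real.exp_le_exp.mpr (by linarith)
      calc (1 : ℝ) ≤ p := hp1
        _ = 1 * (p : ℝ) ^ 2 * (p : ℝ)⁻¹ := by field_simp
        _ ≤ _ := by gcongr
    exact le_trans (by linarith) measureReal_nonneg
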